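/- Let $(\mathcal X,\mathfrak A,\sigma)$ be a $\sigma$-finite measure space with an atomic filtration: an increasing sequence $(\mathfrak A_n)_{n\in\mathbb Z}$ of sub-$\sigma$-algebras of $\mathfrak A$, each having a countable collection $\mathcal D_n\subset\mathfrak A_n$ of disjoint sets of finite measure (atoms) such that every set of $\mathfrak A_n$ is a union of sets in $\mathcal D_n$. An atom is formally a pair $(I,n)$ with $I\in\mathcal D_n$, $\operatorname{rk} I:=n$; $\mathcal D$ is the collection of all atoms; $I'\subset I$ for atoms means inclusion of sets and $\operatorname{rk}I'\ge\operatorname{rk}I$; $\mathcal D(I)=\{I'\in\mathcal D: I'\subset I\}$; the children $\operatorname{ch} I$ are the atoms $I'\subset I$ with $\operatorname{rk} I'=\operatorname{rk} I+1$. Put $\langle f\rangle_I=\sigma(I)^{-1}\int_I f\,d\sigma$ ($=0$ if $\sigma(I)=0$) and $$\Delta_I f=\sum_{I'\in\operatorname{ch}I}\langle f\rangle_{I'}\mathbf 1_{I'}-\langle f\rangle_I\mathbf 1_I .$$ "Locally integrable" means integrable on every atom. Let $\mathbb F=\mathbb R$ or $\mathbb C$. A matrix weight is a locally integrable function on $\mathcal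 X$ with positive semidefinite $d\times d$ values over $\mathbb F$ (almost everywhere). Let $W$ be a matrix $\mathbf A_2$ weight, that is, $W$ is a matrix weight, $W$ is invertible a.e., $W^{-1}$ is a matrix weight, and $$[W]_{\mathbf A_2}:=\sup_{I\in\mathcal D}\bigl\|\langle W\rangle_I^{1/2}\langle W^{-1}\rangle_I^{1/2}\bigr\|^2<\infty .$$ For a scalar weight $w$ let $[w]_{A_\infty}\in[0,\infty]$ be the best constant $C$ such that $\langle M_Iw\rangle_I\le C\langle w\rangle_I$ for all $I\in\mathcal D$, where $M_Iw(x)=\sup\{|\langle w\rangle_{I'}|: I'\in\mathcal D(I),\ x\in I'\}$ for $x\in I$ and $M_Iw(x)=0$ for $x\notin I$; for a matrix weight $U$ let $[U]_{\mathbf A_\infty}=\sup_{e\in\mathbb F^d}[(U e,e)]_{A_\infty}$. Let $L^2(W)$ be the set of measurable $f:\mathcal X\to\mathbb F^d$ with $\|f\|_{L^2(W)}^2=\int_{\mathcal X}(W(x)f(x),f(x))\,d\sigma(x)<\infty$, and $$S^Wf(x)=\Bigl(\sum_{I\in\mathcal D}\bigl|W(x)^{1/2}\Delta_If(x)\bigr|^2\Bigr)^{1/2}.$$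 Then every $f\in L^2(W)$ is locally integrable (so that $S^Wf$ is defined), and $$\|S^Wf\|_{L^2}\le C\,[W]_{\mathbf A_2}^{1/2}\,[W^{-1}]_{\mathbf A_\infty}^{1/2}\,\|f\|_{L^2(W)},$$ where the constant $C<\infty$ depends only on $d$. -/

import Mathlib

open MeasureTheory
open scoped ENNReal NNReal MatrixOrder ComplexOrder

universe u v

noncomputable section

namespace AtomicSq

/-- An atomic filtration on a measure space: an increasing sequence `ℱ n`, `n ∈ ℤ`, of
sub-σ-algebras, each of which has a countable collection `D n` of disjoint atoms of finite measure,
so that the sets of `ℱ n` are exactly the unions of atoms from `D n`. -/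
structure AtomicFiltration {X : Type v} [m : MeasurableSpace X] (σ : Measure X) where
  /-- the σ-algebras -/
  ℱ : Filtration ℤ m
  /-- the atoms of generation `n` -/
  D : ℤ → Set (Set X)
  countable_D : ∀ n, (D n).Countable
  disjoint_D : ∀ n, (D n).PairwiseDisjoint id
  measurableSet_D : ∀ n, ∀ I ∈ D n, MeasurableSet[ℱ n] I
  measure_lt_top : ∀ n, ∀ I ∈ D n, σ I < ∞
  exists_sUnion : ∀ n A, MeasurableSet[ℱ n] A → ∃ S ⊆ D n, A = ⋃₀ S

variable {X : Type v} [MeasurableSpace X] {σ : Measure X}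

/-- An atom is formally a pair `(I, n)` with `I ∈ D n`; the same set may occur in several
generations. -/
structure Atom (𝒟 : AtomicFiltration σ) where
  /-- the generation of the atom -/
  rk : ℤ
  /-- the underlying set -/
  set : Set X
  mem : set ∈ 𝒟.D rk

/-- The atoms contained in `I`: inclusion of the sets together with `rk I' ≥ rk I`. -/
def Atom.descendants {𝒟 : AtomicFiltration σ} (I : Atom 𝒟) : Set (Atom 𝒟) :=
  {I' | I'.set ⊆ I.set ∧ I.rk ≤ I'.rk}

/-- The children of `I`: the atoms of the next generation contained in `I`. -/
def Atom.children {𝒟 : AtomicFiltration σ} (I : Atom 𝒟) : Set (Atom 𝒟) :=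
  {I' | I'.set ⊆ I.set ∧ I'.rk = I.rk + 1}

/-- Locally integrable: integrable on every atom. -/
def LocInt {E : Type*} [NormedAddCommGroup E] (𝒟 : AtomicFiltration σ) (f : X → E) : Prop :=
  ∀ I : Atom 𝒟, IntegrableOn f I.set σ

/-- The martingale difference
`Δ_I f = ∑_{I' ∈ ch I} ⟨f⟩_{I'} 1_{I'} - ⟨f⟩_I 1_I`. At every point at most one term of the sum over
the (disjoint) children is nonzero. Averages over sets of measure zero are zero. -/
def martDiff {E : Type*} [NormedAddCommGroup E] [NormedSpace ℝ E] {𝒟 : AtomicFiltration σ}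
    (I : Atom 𝒟) (f : X → E) (x : X) : E :=
  (∑' I' : I.children, I'.1.set.indicator (fun _ => ⨍ y in I'.1.set, f y ∂σ) x)
    - I.set.indicator (fun _ => ⨍ y in I.set, f y ∂σ) x

section Matrix

variable {𝕜 : Type u} [RCLike 𝕜] {d : ℕ}

/-- The Euclidean operator norm of a matrix, as an extended nonnegative number. -/
def opNorm (A : Matrix (Fin d) (Fin d) 𝕜) : ℝ≥0∞ :=
  ‖Matrix.toEuclideanCLM (n := Fin d) (𝕜 := 𝕜) A‖ₑ

/-- The average of a matrix valued function over a set (taken entrywise). -/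
def matAvg (σ : Measure X) (W : X → Matrix (Fin d) (Fin d) 𝕜) (I : Set X) :
    Matrix (Fin d) (Fin d) 𝕜 :=
  Matrix.of fun i j => ⨍ x in I, W x i j ∂σ

/-- A matrix weight: a locally integrable function with positive semidefinite values. -/
structure IsMatrixWeight (𝒟 : AtomicFiltration σ) (W : X → Matrix (Fin d) (Fin d) 𝕜) : Prop where
  posSemidef : ∀ᵐ x ∂σ, (W x).PosSemidef
  locInt : ∀ i j, LocInt 𝒟 fun x => W x i j

/-- The martingale `A₂` characteristic
`sup_I ‖⟨W⟩_I^{1/2} ⟨W⁻¹⟩_I^{1/2}‖²`. -/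
def A2Char (𝒟 : AtomicFiltration σ) (W : X → Matrix (Fin d) (Fin d) 𝕜) : ℝ≥0∞ :=
  ⨆ I : Atom 𝒟,
    opNorm (CFC.sqrt (matAvg σ W I.set) * CFC.sqrt (matAvg σ (fun x => (W x)⁻¹) I.set)) ^ 2

/-- `W` is a matrix `A₂` weight: it is a matrix weight, invertible almost everywhere, `W⁻¹` is a
matrix weight as well (so that the averages in the characteristic make sense), and the `A₂`
characteristic is finite. -/
structure IsA2Weight (𝒟 : AtomicFiltration σ) (W : X → Matrix (Fin d) (Fin d) 𝕜) : Prop where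
  weight : IsMatrixWeight 𝒟 W
  invertible : ∀ᵐ x ∂σ, IsUnit (W x)
  weight_inv : IsMatrixWeight 𝒟 fun x => (W x)⁻¹
  finite : A2Char 𝒟 W < ∞

/-- The maximal function localized to the atom `I`:
`M_I w (x) = sup {|⟨w⟩_{I'}| : I' ⊆ I an atom, x ∈ I'}`, and `0` for `x ∉ I`. -/
def localMax {𝒟 : AtomicFiltration σ} (I : Atom 𝒟) (w : X → ℝ) (x : X) : ℝ≥0∞ :=
  ⨆ (I' : Atom 𝒟) (_ : I' ∈ I.descendants) (_ : x ∈ I'.set), ‖⨍ y in I'.set, w y ∂σ‖ₑ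

/-- The martingale `A_∞` characteristic of a scalar weight: the best constant `C` in
`⟨M_I w⟩_I ≤ C ⟨w⟩_I` over all atoms `I` (`∞` if there is no finite one). -/
def scalarAInfChar (𝒟 : AtomicFiltration σ) (w : X → ℝ) : ℝ≥0∞ :=
  sInf {C : ℝ≥0∞ | ∀ I : Atom 𝒟,
    ⨍⁻ x in I.set, localMax I w x ∂σ ≤ C * ENNReal.ofReal (⨍ x in I.set, w x ∂σ)}

/-- The quadratic form `(A e, e)`, a real number when `A` is Hermitian. -/
def quadForm (A : Matrix (Fin d) (Fin d) 𝕜) (e : EuclideanSpace 𝕜 (Fin d)) : ℝ :=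
  RCLike.re (inner 𝕜 e (Matrix.toEuclideanCLM (n := Fin d) (𝕜 := 𝕜) A e))

/-- The scalar martingale `A_∞` characteristic of a matrix weight:
the supremum over vectors `e` of the `A_∞` characteristics of the scalar weights
`x ↦ (W(x) e, e)`. -/
def AInfChar (𝒟 : AtomicFiltration σ) (W : X → Matrix (Fin d) (Fin d) 𝕜) : ℝ≥0∞ :=
  ⨆ e : EuclideanSpace 𝕜 (Fin d), scalarAInfChar 𝒟 fun x => quadForm (W x) e

/-- The norm of the weighted space `L²(W)`:
`(∫ (W(x) f(x), f(x)) dσ)^{1/2}`. -/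
def normL2W (σ : Measure X) (W : X → Matrix (Fin d) (Fin d) 𝕜)
    (f : X → EuclideanSpace 𝕜 (Fin d)) : ℝ≥0∞ :=
  (∫⁻ x, ENNReal.ofReal (quadForm (W x) (f x)) ∂σ) ^ (1 / 2 : ℝ)

/-- Membership in `L²(W)`: measurable, with finite norm. -/
def MemL2W (σ : Measure X) (W : X → Matrix (Fin d) (Fin d) 𝕜)
    (f : X → EuclideanSpace 𝕜 (Fin d)) : Prop :=
  AEStronglyMeasurable f σ ∧ normL2W σ W f < ∞

/-- The weighted square function
`S^W f(x) = (∑_I |W(x)^{1/2} Δ_I f(x)|²)^{1/2}`, the sum being over all atoms. -/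
def squareFn (𝒟 : AtomicFiltration σ) (W : X → Matrix (Fin d) (Fin d) 𝕜)
    (f : X → EuclideanSpace 𝕜 (Fin d)) (x : X) : ℝ≥0∞ :=
  (∑' I : Atom 𝒟,
    ‖Matrix.toEuclideanCLM (n := Fin d) (𝕜 := 𝕜) (CFC.sqrt (W x)) (martDiff I f x)‖ₑ ^ 2)
      ^ (1 / 2 : ℝ)

end Matrix

end AtomicSq

end

open AtomicSq

/-!
Over `ℝ` or `ℂ` the space `𝕜ᵈ` is a real inner product space `E` of dimension at most `2 * d`, and
a matrix weight `W` with inverse `V = W⁻¹` becomes a pair of positive operator weights on `E`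
(`IsA2Weight.isWeightPair`). The `A₂` condition reads `(⟨W⟩ ⟨V⟩ e, ⟨V⟩ e) ≤ A (⟨V⟩ e, e)` on every
atom. On an atom the martingale difference of `f` is the difference `F' - F` of two consecutive
averages, so one has to bound the sum over all generations of `∫ (W (F' - F), F' - F)`.

Write `F = ⟨V⟩ g` and `F' = ⟨V⟩' g'`. Then `F' - F = ⟨V⟩' (g' - g) + (⟨V⟩' - ⟨V⟩) g`.

* The first part, by the `A₂` condition, costs `A (⟨V⟩' (g' - g), g' - g)`. This is exactly the
  gap in the convexity of the Bellman function `(F, U) ↦ (F, U⁻¹ F)` at `U = ⟨V⟩`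
  (`bellman_step`), and the gaps add up to at most `∫ (W f, f)` (`IsWeightPair.sum_bellman_le`).
* The second part is a Carleson sum with the operators `T = (⟨V⟩' - ⟨V⟩) W (⟨V⟩' - ⟨V⟩)`. Its
  testing condition, `∑ ∫_J (T e, e) ≤ K ∫_J (V e, e)` for the generations below any atom `J`,
  holds with `K` a multiple of `A` times the `A_∞` constant of the scalar weights `(V e, e)`: a
  stopping time keeps the martingale of `V e` and its square function, in coordinates adapted to
  `⟨V⟩_J`, bounded on at least half of `J`, and what is summed over the stopped parts is the
  maximal function (`IsWeightPair.testing`). The embedding `∑ ∫ (T g, g) ≤ C K ∫ (W f, f)` then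
  follows from the same Bellman function, applied to `V` raised by a multiple of the remaining
  Carleson sum (`IsWeightPair.carleson`). This gives the terms with `(⟨V⟩ + s M)⁻¹ F`, where `0 ≤
  M ≤ ⟨V⟩`, in place of `g = ⟨V⟩⁻¹ F`. Since the operators need not commute, these are not
  comparable for one `s`; but by Cramer's rule `s ↦ det (1 + s N) (1 + s N)⁻¹` is a polynomial of
  degree at most `dim E`, and interpolation between `dim E + 1` values of `s` recovers `s = 0`
  (`exists_interp`).

All constants depend on `dim E` only, and both `A` and `K` are at most a multiple of `[W]_{A₂}
[W⁻¹]_{A_∞}`, because the `A_∞` characteristic is at least one unless the norm of `f` vanishes.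
-/

noncomputable section

namespace AtomicSq

/-! ### Cells of an atomic filtration and averages over them -/

section

namespace AtomicFiltration

variable {X : Type v} [MeasurableSpace X] {σ : Measure X} (𝒟 : AtomicFiltration σ)

/-- The atom of generation `n` that contains `x`. -/
def cell (n : ℤ) (x : X) : Set X := ⋃₀ {I ∈ 𝒟.D n | x ∈ I}

variable {𝒟}

theorem cell_eq {n : ℤ} {I : Set X} (hI : I ∈ 𝒟.D n) {x : X} (hx : x ∈ I) : 𝒟.cell n x = I := by
  have : {J ∈ 𝒟.D n | x ∈ J} = {I} := by
    ext J
    simp only [Set.mem_ofPred_eq, Set.mem_singleton_iff]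
    constructor
    · rintro ⟨hJ, hxJ⟩
      exact (𝒟.disjoint_D n).elim_set hJ hI x hxJ hx
    · rintro rfl
      exact ⟨hI, hx⟩
  rw [cell, this, Set.sUnion_singleton]

variable (𝒟) in
theorem exists_mem_atom (n : ℤ) (x : X) : ∃ I ∈ 𝒟.D n, x ∈ I := by
  obtain ⟨S, hS, h⟩ := 𝒟.exists_sUnion n Set.univ MeasurableSet.univ
  have : x ∈ ⋃₀ S := h ▸ Set.mem_univ x
  obtain ⟨I, hI, hx⟩ := this
  exact ⟨I, hS hI, hx⟩

variable (𝒟) in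
theorem cell_mem (n : ℤ) (x : X) : 𝒟.cell n x ∈ 𝒟.D n := by
  obtain ⟨I, hI, hx⟩ := 𝒟.exists_mem_atom n x
  rwa [cell_eq hI hx]

variable (𝒟) in
theorem mem_cell (n : ℤ) (x : X) : x ∈ 𝒟.cell n x := by
  obtain ⟨I, hI, hx⟩ := 𝒟.exists_mem_atom n x
  rwa [cell_eq hI hx]

theorem cell_subset {n : ℤ} {A : Set X} (hA : MeasurableSet[𝒟.ℱ n] A) {x : X} (hx : x ∈ A) :
    𝒟.cell n x ⊆ A := by
  obtain ⟨S, hS, rfl⟩ := 𝒟.exists_sUnion n A hA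
  obtain ⟨I, hI, hxI⟩ := hx
  rw [cell_eq (hS hI) hxI]
  exact Set.subset_sUnion_of_mem hI

theorem measurableSet_of_mem {n : ℤ} {I : Set X} (hI : I ∈ 𝒟.D n) : MeasurableSet I :=
  𝒟.ℱ.le n _ (𝒟.measurableSet_D n I hI)

theorem measurableSet_of_mem_le {n m : ℤ} (h : n ≤ m) {I : Set X} (hI : I ∈ 𝒟.D n) :
    MeasurableSet[𝒟.ℱ m] I :=
  𝒟.ℱ.mono h _ (𝒟.measurableSet_D n I hI)

/-- Every function of the cell of generation `n` is `ℱ n`-measurable, since there are only countably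
many cells. -/
theorem measurableSet_cell_preimage (n : ℤ) (S : Set (Set X)) :
    MeasurableSet[𝒟.ℱ n] {x | 𝒟.cell n x ∈ S} := by
  have : {x | 𝒟.cell n x ∈ S} = ⋃ I ∈ 𝒟.D n ∩ S, I := by
    ext x
    simp only [Set.mem_ofPred_eq, Set.mem_iUnion, exists_prop]
    constructor
    · intro h
      exact ⟨_, ⟨𝒟.cell_mem n x, h⟩, 𝒟.mem_cell n x⟩
    · rintro ⟨I, ⟨hI, hS⟩, hx⟩
      rwa [cell_eq hI hx]
  rw [this]
  exact MeasurableSet.biUnion ((𝒟.countable_D n).mono Set.inter_subset_left)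
    fun I hI => 𝒟.measurableSet_D n I hI.1

theorem stronglyMeasurable_comp_cell {β : Type*} [TopologicalSpace β]
    [TopologicalSpace.PseudoMetrizableSpace β] (n : ℤ) (G : Set X → β) :
    StronglyMeasurable fun x => G (𝒟.cell n x) := by
  borelize β
  rw [stronglyMeasurable_iff_measurable_separable]
  refine ⟨fun s _ => 𝒟.ℱ.le n _ (measurableSet_cell_preimage n (G ⁻¹' s)), ?_⟩
  refine Set.Countable.isSeparable (((𝒟.countable_D n).image G).mono ?_)
  rintro _ ⟨x, rfl⟩
  exact ⟨_, 𝒟.cell_mem n x, rfl⟩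

/-- A set of `ℱ n` is the disjoint union of the atoms of generation `n` that it contains. -/
theorem eq_biUnion_atoms {n : ℤ} {A : Set X} (hA : MeasurableSet[𝒟.ℱ n] A) :
    A = ⋃ I ∈ {I ∈ 𝒟.D n | I ⊆ A}, I := by
  ext x
  simp only [Set.mem_iUnion, exists_prop]
  constructor
  · intro hx
    exact ⟨_, ⟨𝒟.cell_mem n x, cell_subset hA hx⟩, 𝒟.mem_cell n x⟩
  · rintro ⟨I, ⟨_, hIA⟩, hx⟩
    exact hIA hx

theorem countable_atoms (n : ℤ) (A : Set X) : {I ∈ 𝒟.D n | I ⊆ A}.Countable :=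
  (𝒟.countable_D n).mono fun _ h => h.1

/-- An inequality between integrals over all atoms of generation `n` in a set of `ℱ n` gives the
inequality over that set. -/
theorem setLIntegral_mono_of_atoms {n : ℤ} {A : Set X} (hA : MeasurableSet[𝒟.ℱ n] A)
    {φ ψ : X → ℝ≥0∞} (h : ∀ I ∈ 𝒟.D n, I ⊆ A → ∫⁻ x in I, φ x ∂σ ≤ ∫⁻ x in I, ψ x ∂σ) :
    ∫⁻ x in A, φ x ∂σ ≤ ∫⁻ x in A, ψ x ∂σ := by
  have key (φ : X → ℝ≥0∞) := lintegral_biUnion (μ := σ) (countable_atoms (𝒟 := 𝒟) n A)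
    (s := id) (fun I hI => measurableSet_of_mem hI.1)
    ((𝒟.disjoint_D n).subset fun _ h => h.1) φ
  have hA' := eq_biUnion_atoms hA
  simp only [id] at key
  rw [hA', key, key]
  exact ENNReal.tsum_le_tsum fun I => h I.1 I.2.1 I.2.2

/-- Equality of integrals over all atoms of generation `n` in a set of `ℱ n` gives the equality over
that set. -/
theorem setIntegral_congr_of_atoms {E : Type*} [NormedAddCommGroup E] [NormedSpace ℝ E]
    {n : ℤ} {A : Set X} (hA : MeasurableSet[𝒟.ℱ n] A)
    {φ ψ : X → E} (hφ : IntegrableOn φ A σ) (hψ : IntegrableOn ψ A σ)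
    (h : ∀ I ∈ 𝒟.D n, I ⊆ A → ∫ x in I, φ x ∂σ = ∫ x in I, ψ x ∂σ) :
    ∫ x in A, φ x ∂σ = ∫ x in A, ψ x ∂σ := by
  have hA' := eq_biUnion_atoms hA
  have hc := (countable_atoms (𝒟 := 𝒟) n A).to_subtype
  rw [Set.biUnion_eq_iUnion] at hA'
  have key (φ : X → E) (hφ : IntegrableOn φ A σ) :=
    integral_iUnion (μ := σ) (f := φ) (s := fun I : {I ∈ 𝒟.D n | I ⊆ A} => I.1)
      (fun I => measurableSet_of_mem I.2.1)
      (fun I J hIJ => 𝒟.disjoint_D n I.2.1 J.2.1 fun h => hIJ (Subtype.ext h)) (hA' ▸ hφ)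
  rw [hA', key φ hφ, key ψ hψ]
  exact tsum_congr fun I => h I.1 I.2.1 I.2.2

section Avg

variable {E : Type*} [NormedAddCommGroup E] [NormedSpace ℝ E]

variable (𝒟) in
/-- The conditional expectation of `f` with respect to `ℱ n`: at `x`, the average of `f` over the
atom of generation `n` that contains `x`. -/
def avg (n : ℤ) (f : X → E) (x : X) : E := ⨍ y in 𝒟.cell n x, f y ∂σ

theorem avg_eq {n : ℤ} {I : Set X} (hI : I ∈ 𝒟.D n) {x : X} (hx : x ∈ I) (f : X → E) :
    𝒟.avg n f x = ⨍ y in I, f y ∂σ := by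
  rw [avg, cell_eq hI hx]

theorem stronglyMeasurable_avg (n : ℤ) (f : X → E) : StronglyMeasurable (𝒟.avg n f) :=
  stronglyMeasurable_comp_cell n fun I => ⨍ y in I, f y ∂σ

theorem measure_ne_top {n : ℤ} {I : Set X} (hI : I ∈ 𝒟.D n) : σ I ≠ ∞ :=
  (𝒟.measure_lt_top n I hI).ne

theorem measureReal_smul_setAverage {n : ℤ} {I : Set X} (hI : I ∈ 𝒟.D n) (f : X → E) :
    σ.real I • ⨍ y in I, f y ∂σ = ∫ y in I, f y ∂σ :=
  measure_smul_setAverage f (measure_ne_top hI)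

theorem setIntegral_avg_atom [CompleteSpace E] {n : ℤ} {I : Set X} (hI : I ∈ 𝒟.D n) (f : X → E) :
    ∫ x in I, 𝒟.avg n f x ∂σ = ∫ x in I, f x ∂σ := by
  rw [setIntegral_congr_fun (measurableSet_of_mem hI) fun x hx => avg_eq hI hx f,
    setIntegral_const, measureReal_smul_setAverage hI]

theorem setLIntegral_avg_atom_le {n : ℤ} {I : Set X} (hI : I ∈ 𝒟.D n) (f : X → E) :
    ∫⁻ x in I, ‖𝒟.avg n f x‖ₑ ∂σ ≤ ∫⁻ x in I, ‖f x‖ₑ ∂σ := by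
  rw [setLIntegral_congr_fun (measurableSet_of_mem hI) (g := fun _ => ‖⨍ y in I, f y ∂σ‖ₑ)
    fun x hx => by rw [avg_eq hI hx f], setLIntegral_const]
  calc ‖⨍ y in I, f y ∂σ‖ₑ * σ I = ‖σ.real I • ⨍ y in I, f y ∂σ‖ₑ := by
        rw [enorm_smul, mul_comm, measureReal_def, Real.enorm_of_nonneg ENNReal.toReal_nonneg,
          ENNReal.ofReal_toReal (measure_ne_top hI)]
    _ = ‖∫ y in I, f y ∂σ‖ₑ := by rw [measureReal_smul_setAverage hI]
    _ ≤ _ := enorm_integral_le_lintegral_enorm _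

theorem setLIntegral_avg_le {n : ℤ} {A : Set X} (hA : MeasurableSet[𝒟.ℱ n] A) (f : X → E) :
    ∫⁻ x in A, ‖𝒟.avg n f x‖ₑ ∂σ ≤ ∫⁻ x in A, ‖f x‖ₑ ∂σ :=
  setLIntegral_mono_of_atoms hA fun _ hI _ => setLIntegral_avg_atom_le hI f

theorem integrableOn_avg {n : ℤ} {A : Set X} (hA : MeasurableSet[𝒟.ℱ n] A) {f : X → E}
    (hf : IntegrableOn f A σ) : IntegrableOn (𝒟.avg n f) A σ :=
  ⟨(stronglyMeasurable_avg n f).aestronglyMeasurable, (setLIntegral_avg_le hA f).trans_lt hf.2⟩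

theorem setIntegral_avg [CompleteSpace E] {n : ℤ} {A : Set X} (hA : MeasurableSet[𝒟.ℱ n] A)
    {f : X → E} (hf : IntegrableOn f A σ) : ∫ x in A, 𝒟.avg n f x ∂σ = ∫ x in A, f x ∂σ :=
  setIntegral_congr_of_atoms hA (integrableOn_avg hA hf) hf
    fun _ hI _ => setIntegral_avg_atom hI f

theorem ae_measure_cell_ne_zero : ∀ᵐ x ∂σ, ∀ n, σ (𝒟.cell n x) ≠ 0 := by
  rw [ae_all_iff]
  intro n
  rw [ae_iff]
  have : {x | ¬ σ (𝒟.cell n x) ≠ 0} = ⋃ I ∈ {I ∈ 𝒟.D n | σ I = 0}, I := by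
    ext x
    simp only [not_not, Set.mem_ofPred_eq, Set.mem_iUnion, exists_prop]
    constructor
    · intro h
      exact ⟨_, ⟨𝒟.cell_mem n x, h⟩, 𝒟.mem_cell n x⟩
    · rintro ⟨I, ⟨hI, h0⟩, hx⟩
      rwa [cell_eq hI hx]
  rw [this, measure_biUnion_null_iff ((𝒟.countable_D n).mono fun _ h => h.1)]
  exact fun I hI => hI.2

end Avg

end AtomicFiltration

end

/-! ### Positive operators and interpolation of the resolvent of a pencil -/

section

section Form

variable {E : Type*} [NormedAddCommGroup E] [InnerProductSpace ℝ E]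

/-- The quadratic form of an operator on a real inner product space. -/
def form (T : E →L[ℝ] E) (e : E) : ℝ := inner ℝ (T e) e

/-- Positive definite operators. -/
structure IsPosDef (T : E →L[ℝ] E) : Prop where
  isPositive : T.IsPositive
  form_pos : ∀ e, e ≠ 0 → 0 < form T e

theorem form_nonneg {T : E →L[ℝ] E} (hT : T.IsPositive) (e : E) : 0 ≤ form T e :=
  hT.inner_nonneg_left e

theorem inner_symm_of_isPositive {T : E →L[ℝ] E} (hT : T.IsPositive) (x y : E) :
    inner ℝ (T x) y = inner ℝ x (T y) := hT.1 x y

@[simp] theorem form_zero (T : E →L[ℝ] E) : form T 0 = 0 := by simp [form]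

theorem form_smul (T : E →L[ℝ] E) (c : ℝ) (e : E) : form T (c • e) = c ^ 2 * form T e := by
  simp only [form, map_smul, inner_smul_left, inner_smul_right, RCLike.conj_to_real]
  ring

theorem form_add_le {T : E →L[ℝ] E} (hT : T.IsPositive) (x y : E) :
    form T (x + y) ≤ 2 * form T x + 2 * form T y := by
  have h := form_nonneg hT (x - y)
  simp only [form, map_add, map_sub, inner_add_left, inner_add_right, inner_sub_left,
    inner_sub_right] at h ⊢
  linarith

theorem form_sub_le {T : E →L[ℝ] E} (hT : T.IsPositive) (x y : E) :
    form T (x - y) ≤ 2 * form T x + 2 * form T y := by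
  have h := form_nonneg hT (x + y)
  simp only [form, map_add, map_sub, inner_add_left, inner_add_right, inner_sub_left,
    inner_sub_right] at h ⊢
  linarith

theorem form_sum_le {T : E →L[ℝ] E} (hT : T.IsPositive) {ι : Type*} (s : Finset ι) (y : ι → E) :
    form T (∑ i ∈ s, y i) ≤ 2 ^ s.card * ∑ i ∈ s, form T (y i) := by
  classical
  induction s using Finset.induction_on with
  | empty => simp
  | insert i s hi ih =>
    rw [Finset.sum_insert hi, Finset.sum_insert hi, Finset.card_insert_of_notMem hi]
    have h1 := form_add_le hT (y i) (∑ j ∈ s, y j)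
    have h2 := form_nonneg hT (y i)
    have h3 : (1 : ℝ) ≤ 2 ^ s.card := one_le_pow₀ (by norm_num)
    have h4 : form T (y i) ≤ 2 ^ s.card * form T (y i) := le_mul_of_one_le_left h2 h3
    rw [pow_succ]
    linarith

theorem abs_inner_le_of_isPositive {T : E →L[ℝ] E} (hT : T.IsPositive) (x y : E) :
    2 * |inner ℝ (T x) y| ≤ form T x + form T y := by
  have h1 := form_nonneg hT (x - y)
  have h2 := form_nonneg hT (x + y)
  have h3 : inner ℝ (T y) x = inner ℝ (T x) y := by
    rw [inner_symm_of_isPositive hT, real_inner_comm]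
  simp only [form, map_add, map_sub, inner_add_left, inner_add_right, inner_sub_left,
    inner_sub_right] at h1 h2 ⊢
  have := abs_le.2 (⟨by linarith, by linarith⟩ :
    -((inner ℝ (T x) x + inner ℝ (T y) y) / 2) ≤ inner ℝ (T x) y ∧
      inner ℝ (T x) y ≤ (inner ℝ (T x) x + inner ℝ (T y) y) / 2)
  linarith

theorem IsPosDef.injective {T : E →L[ℝ] E} (hT : IsPosDef T) : Function.Injective T := by
  rw [injective_iff_map_eq_zero]
  intro e he
  by_contra h
  have := hT.form_pos e h
  simp [form, he] at this

variable [FiniteDimensional ℝ E]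

theorem IsPosDef.surjective {T : E →L[ℝ] E} (hT : IsPosDef T) : Function.Surjective T :=
  LinearMap.injective_iff_surjective.1 hT.injective

/-- A basis `c` orthonormal for the inner product given by a positive definite operator `V`; the
vectors `V (c i)` form its dual basis. -/
theorem IsPosDef.exists_orthonormal {V : E →L[ℝ] E} (hV : IsPosDef V) {D : ℕ}
    (hD : Module.finrank ℝ E = D) :
    ∃ c : Fin D → E, (∀ i j, inner ℝ (V (c i)) (c j) = if i = j then 1 else 0) ∧
      ∀ F, F = ∑ i, inner ℝ F (c i) • V (c i) := by
  have hs : (V : E →ₗ[ℝ] E).IsSymmetric := hV.isPositive.1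
  let b := hs.eigenvectorBasis hD
  let μ := hs.eigenvalues hD
  have hb : ∀ i, V (b i) = μ i • b i := fun i => hs.apply_eigenvectorBasis hD i
  have hμ : ∀ i, 0 < μ i := by
    intro i
    have h0 : b i ≠ 0 := b.orthonormal.ne_zero i
    have := hV.form_pos (b i) h0
    simpa [form, hb, inner_smul_left, b.orthonormal.1 i] using this
  have hsq : ∀ i, √(μ i) ≠ 0 := fun i => (Real.sqrt_pos.2 (hμ i)).ne'
  have hVc : ∀ i, V ((√(μ i))⁻¹ • b i) = √(μ i) • b i := by
    intro i
    rw [map_smul, hb, smul_smul]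
    congr 1
    rw [inv_mul_eq_iff_eq_mul₀ (hsq i), Real.mul_self_sqrt (hμ i).le]
  refine ⟨fun i => (√(μ i))⁻¹ • b i, fun i j => ?_, fun F => ?_⟩
  · have h := orthonormal_iff_ite.1 b.orthonormal i j
    rw [hVc, inner_smul_left, inner_smul_right, h]
    split_ifs with hij
    · subst hij
      simp [hsq i]
    · simp
  · conv_lhs => rw [← b.sum_repr' F]
    refine Finset.sum_congr rfl fun i _ => ?_
    rw [hVc, inner_smul_right, smul_smul, real_inner_comm]
    congr 1
    field_simp [hsq i]

end Form

/-- The interpolation nodes `1 / (D + 1), …, (D + 1) / (D + 1)`. -/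
def node (D : ℕ) (i : Fin (D + 1)) : ℝ := ((i : ℝ) + 1) / (D + 1)

theorem node_pos (D : ℕ) (i : Fin (D + 1)) : 0 < node D i := by unfold node; positivity

theorem node_le_one (D : ℕ) (i : Fin (D + 1)) : node D i ≤ 1 := by
  unfold node
  rw [div_le_one (by positivity)]
  have : (i : ℕ) + 1 ≤ D + 1 := i.2
  exact_mod_cast this

theorem node_injective (D : ℕ) : Function.Injective (node D) := by
  intro i j h
  unfold node at h
  rw [div_left_inj' (by positivity)] at h
  exact Fin.ext (by exact_mod_cast add_right_cancel h)

/-- The bound for the coefficients that express the value at zero of the resolvent of a pencil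
through its values at the nodes. -/
def interpConst (D : ℕ) : ℝ :=
  (D.factorial * 2 ^ D) * ∑ i, |(Lagrange.basis Finset.univ (node D) i).eval 0|

/-- A polynomial of degree at most `D` is determined at zero by its values at the nodes. -/
theorem eval_zero_eq_sum_node {D : ℕ} (p : Polynomial ℝ) (hp : p.natDegree ≤ D) :
    p.eval 0 = ∑ i, (Lagrange.basis Finset.univ (node D) i).eval 0 * p.eval (node D i) := by
  have h := Lagrange.eq_interpolate (s := Finset.univ) (v := node D) (f := p)
    (node_injective D).injOn (by
      refine lt_of_le_of_lt Polynomial.degree_le_natDegree ?_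
      simp only [Finset.card_univ, Fintype.card_fin]
      exact_mod_cast Nat.lt_succ_of_le hp)
  conv_lhs => rw [h, Lagrange.interpolate_apply, Polynomial.eval_finsetSum]
  refine Finset.sum_congr rfl fun i _ => ?_
  simp [mul_comm]

/-- By Cramer's rule `det (1 + s N) • (1 + s N)⁻¹ φ` is a polynomial in `s` of degree at most `D`,
so that its value at zero is a combination of those at the nodes. -/
theorem exists_interp_matrix {D : ℕ} (N : Matrix (Fin D) (Fin D) ℝ) (hN : ∀ i j, |N i j| ≤ 1)
    (φ γ₀ : Fin D → ℝ) (γ : Fin (D + 1) → Fin D → ℝ) (h₀ : γ₀ = φ)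
    (h : ∀ i, (1 + node D i • N).mulVec (γ i) = φ) :
    ∃ κ : Fin (D + 1) → ℝ, (∀ i, |κ i| ≤ interpConst D) ∧ γ₀ = ∑ i, κ i • γ i := by
  let L : Fin (D + 1) → ℝ := fun i => (Lagrange.basis Finset.univ (node D) i).eval 0
  let P : Fin D → Polynomial ℝ := fun l =>
    ((Polynomial.X : Polynomial ℝ) • (N.updateCol l 0).map Polynomial.C +
      ((1 : Matrix (Fin D) (Fin D) ℝ).updateCol l φ).map Polynomial.C).det
  have hPdeg : ∀ l, (P l).natDegree ≤ D := fun l => by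
    simpa using Polynomial.natDegree_det_X_add_C_le (N.updateCol l 0)
      ((1 : Matrix (Fin D) (Fin D) ℝ).updateCol l φ)
  have hP : ∀ l s, (P l).eval s = (1 + s • N).cramer φ l := by
    intro l s
    rw [Matrix.cramer_apply, ← Polynomial.coe_evalRingHom, RingHom.map_det]
    congr 1
    ext i j
    by_cases hj : j = l
    · subst hj
      simp
    · simp [Matrix.updateCol_ne hj]
      ring
  have hdet : ∀ i, (1 + node D i • N).cramer φ = (1 + node D i • N).det • γ i := by
    intro i
    rw [← h i, Matrix.cramer_eq_adjugate_mulVec, Matrix.mulVec_mulVec, Matrix.adjugate_mul,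
      Matrix.smul_mulVec, Matrix.one_mulVec]
  refine ⟨fun i => L i * (1 + node D i • N).det, fun i => ?_, ?_⟩
  · have hd : |(1 + node D i • N).det| ≤ D.factorial * 2 ^ D := by
      have := Matrix.det_le (A := 1 + node D i • N) (abv := AbsoluteValue.abs) (x := (2 : ℝ)) ?_
      · simpa using this
      intro a b
      simp only [AbsoluteValue.abs_apply, Matrix.add_apply, Matrix.smul_apply, smul_eq_mul]
      refine (abs_add_le _ _).trans ?_
      have h1 : |(1 : Matrix (Fin D) (Fin D) ℝ) a b| ≤ 1 := by
        rw [Matrix.one_apply]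
        split_ifs <;> simp
      have h2 : |node D i * N a b| ≤ 1 := by
        rw [abs_mul, abs_of_pos (node_pos D i)]
        exact mul_le_one₀ (node_le_one D i) (abs_nonneg _) (hN a b)
      linarith
    rw [abs_mul, mul_comm]
    exact mul_le_mul hd (Finset.single_le_sum (f := fun i => |L i|) (fun _ _ => abs_nonneg _)
      (Finset.mem_univ i)) (abs_nonneg _) (by positivity)
  · ext l
    have h1 : (P l).eval 0 = φ l := by rw [hP]; simp
    rw [h₀, ← h1, eval_zero_eq_sum_node (P l) (hPdeg l), Finset.sum_apply]
    refine Finset.sum_congr rfl fun i _ => ?_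
    rw [hP, hdet]
    simp only [Pi.smul_apply, smul_eq_mul, L]
    ring

/-- If `0 ≤ M ≤ V` and `V` is positive definite, then `V⁻¹ F` is a combination of the vectors
`(V + s M)⁻¹ F`, `s` a node, with coefficients bounded in terms of the dimension only. This replaces
the comparison of `V⁻¹ F` with `(V + M)⁻¹ F`, which is immediate only for commuting operators. -/
theorem exists_interp {E : Type*} [NormedAddCommGroup E] [InnerProductSpace ℝ E]
    [FiniteDimensional ℝ E] {D : ℕ} (hD : Module.finrank ℝ E = D) {V M : E →L[ℝ] E}
    (hV : IsPosDef V) (hM : M.IsPositive) (hMV : ∀ e, form M e ≤ form V e)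
    (F c₀ : E) (c : Fin (D + 1) → E) (h₀ : V c₀ = F)
    (h : ∀ i, (V + node D i • M) (c i) = F) :
    ∃ κ : Fin (D + 1) → ℝ, (∀ i, |κ i| ≤ interpConst D) ∧ c₀ = ∑ i, κ i • c i := by
  obtain ⟨b, hb, hF⟩ := hV.exists_orthonormal hD
  -- the coordinates of a vector in the basis `b` are `⟪V c, b i⟫`
  have hcoord : ∀ c, c = ∑ i, inner ℝ (V c) (b i) • b i := fun c => by
    apply hV.injective
    conv_lhs => rw [hF (V c)]
    simp [map_sum]
  have hform : ∀ i, form V (b i) = 1 := fun i => by simp [form, hb]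
  let N : Matrix (Fin D) (Fin D) ℝ := Matrix.of fun i j => inner ℝ (M (b j)) (b i)
  have hN : ∀ i j, |N i j| ≤ 1 := by
    intro i j
    have h1 := abs_inner_le_of_isPositive hM (b j) (b i)
    have h2 := hMV (b i)
    have h3 := hMV (b j)
    rw [hform] at h2 h3
    simp only [N, Matrix.of_apply]
    linarith
  obtain ⟨κ, hκ, hs⟩ := exists_interp_matrix N hN (fun l => inner ℝ F (b l))
    (fun l => inner ℝ (V c₀) (b l)) (fun i l => inner ℝ (V (c i)) (b l)) (by rw [h₀]) (by
      intro i
      ext l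
      have h1 : inner ℝ (M (c i)) (b l) = ∑ j, N l j * inner ℝ (V (c i)) (b j) := by
        conv_lhs => rw [hcoord (c i)]
        rw [map_sum, sum_inner]
        refine Finset.sum_congr rfl fun j _ => ?_
        simp [N, inner_smul_left, mul_comm]
      rw [← h i, Matrix.add_mulVec, Matrix.one_mulVec, Matrix.smul_mulVec]
      simp [inner_add_left, inner_smul_left, h1, Matrix.mulVec, dotProduct])
  refine ⟨κ, hκ, ?_⟩
  rw [hcoord c₀]
  have hs' : ∀ l, inner ℝ (V c₀) (b l) = ∑ i, κ i * inner ℝ (V (c i)) (b l) := fun l => by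
    simpa using congrFun hs l
  simp_rw [hs', Finset.sum_smul]
  rw [Finset.sum_comm]
  refine Finset.sum_congr rfl fun i _ => ?_
  conv_rhs => rw [hcoord (c i), Finset.smul_sum]
  simp [smul_smul]

end

/-! ### Averages of positive operator valued functions -/

section

open AtomicFiltration

variable {X : Type v} [MeasurableSpace X] {σ : Measure X} {𝒟 : AtomicFiltration σ}
variable {E : Type*} [NormedAddCommGroup E] [InnerProductSpace ℝ E]

section Average

theorem integrableOn_fun_add {F : Type*} [NormedAddCommGroup F] {f g : X → F} {I : Set X}
    (hf : IntegrableOn f I σ) (hg : IntegrableOn g I σ) :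
    IntegrableOn (fun x => f x + g x) I σ := hf.add hg

/-- The quadratic form at a fixed vector, as a linear functional of the operator. -/
def formCLM (e : E) : (E →L[ℝ] E) →L[ℝ] ℝ :=
  (innerSL ℝ e).comp (ContinuousLinearMap.apply ℝ E e)

theorem formCLM_apply (e : E) (T : E →L[ℝ] E) : formCLM e T = form T e := by
  simp [formCLM, form, real_inner_comm]

theorem continuous_form : Continuous fun p : (E →L[ℝ] E) × E => form p.1 p.2 := by
  unfold form
  fun_prop

variable {I : Set X} {T : X → E →L[ℝ] E}

theorem integrableOn_form (hT : IntegrableOn T I σ) (e : E) :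
    IntegrableOn (fun x => form (T x) e) I σ := by
  have h := (formCLM e).integrable_comp hT
  simp only [formCLM_apply] at h
  exact h

theorem form_smul_left (r : ℝ) (T : E →L[ℝ] E) (e : E) : form (r • T) e = r * form T e := by
  simp [form, inner_smul_left]

theorem form_add_left (S T : E →L[ℝ] E) (e : E) : form (S + T) e = form S e + form T e := by
  simp [form, inner_add_left]

theorem IsPosDef.add_isPositive {S T : E →L[ℝ] E} (hS : IsPosDef S) (hT : T.IsPositive) :
    IsPosDef (S + T) where
  isPositive := ContinuousLinearMap.IsPositive.add hS.isPositive hT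
  form_pos e he := by
    rw [form_add_left]
    exact add_pos_of_pos_of_nonneg (hS.form_pos e he) (form_nonneg hT e)

variable [CompleteSpace E]

theorem setIntegral_form (hT : IntegrableOn T I σ) (e : E) :
    ∫ x in I, form (T x) e ∂σ = form (∫ x in I, T x ∂σ) e := by
  simpa only [formCLM_apply] using (formCLM e).integral_comp_comm hT

theorem setIntegral_form_eq {n : ℤ} (hI : I ∈ 𝒟.D n) (hT : IntegrableOn T I σ) (e : E) :
    ∫ x in I, form (T x) e ∂σ = σ.real I * form (⨍ x in I, T x ∂σ) e := by
  rw [setIntegral_form hT, ← measureReal_smul_setAverage hI, form_smul_left]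

theorem setLIntegral_form_eq {n : ℤ} (hI : I ∈ 𝒟.D n) (hT : IntegrableOn T I σ)
    (hpos : ∀ᵐ x ∂σ, (T x).IsPositive) (e : E) :
    ∫⁻ x in I, ENNReal.ofReal (form (T x) e) ∂σ =
      ENNReal.ofReal (σ.real I * form (⨍ x in I, T x ∂σ) e) := by
  rw [← setIntegral_form_eq hI hT, ofReal_integral_eq_lintegral_ofReal (integrableOn_form hT e)]
  filter_upwards [ae_restrict_of_ae hpos] with x hx using form_nonneg hx e

theorem isPositive_setAverage (hT : IntegrableOn T I σ) (hpos : ∀ᵐ x ∂σ, (T x).IsPositive) :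
    (⨍ x in I, T x ∂σ).IsPositive := by
  have hint : (∫ x in I, T x ∂σ).IsPositive := by
    refine ⟨fun x y => ?_, fun x => ?_⟩
    · simp only [ContinuousLinearMap.coe_coe]
      rw [ContinuousLinearMap.integral_apply hT, ContinuousLinearMap.integral_apply hT,
        real_inner_comm, ← integral_inner (hT.apply_continuousLinearMap x),
        ← integral_inner (hT.apply_continuousLinearMap y)]
      refine integral_congr_ae ?_
      filter_upwards [ae_restrict_of_ae hpos] with z hz
      rw [real_inner_comm, inner_symm_of_isPositive hz]
    · change 0 ≤ inner ℝ _ _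
      have h := setIntegral_form hT x
      unfold form at h
      rw [← h]
      refine integral_nonneg_of_ae ?_
      filter_upwards [ae_restrict_of_ae hpos] with z hz using form_nonneg hz x
  rw [setAverage_eq]
  exact hint.smul_of_nonneg (by positivity)

theorem isPosDef_setAverage (hT : IntegrableOn T I σ) (hpos : ∀ᵐ x ∂σ, IsPosDef (T x))
    (h0 : σ I ≠ 0) (hI : σ I ≠ ∞) : IsPosDef (⨍ x in I, T x ∂σ) := by
  refine ⟨isPositive_setAverage hT (hpos.mono fun _ h => h.isPositive), fun e he => ?_⟩
  rw [setAverage_eq, form_smul_left, ← setIntegral_form hT]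
  have h1 : 0 < σ.real I := ENNReal.toReal_pos h0 hI
  refine mul_pos (inv_pos.2 h1) ?_
  rw [integral_pos_iff_support_of_nonneg_ae]
  · have : (Function.support fun x => form (T x) e) =ᵐ[σ.restrict I] Set.univ := by
      filter_upwards [ae_restrict_of_ae hpos] with x hx
      exact propext ⟨fun _ => trivial, fun _ => (hx.form_pos e he).ne'⟩
    rw [measure_congr this, Measure.restrict_apply_univ]
    exact pos_iff_ne_zero.2 h0
  · filter_upwards [ae_restrict_of_ae hpos] with x hx using (hx.form_pos e he).le
  · exact integrableOn_form hT e

end Average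

/-! ### The Bellman function `⟪F, U⁻¹ F⟫` -/

section Bellman

/-- The solution of `⟨R⟩_I c = ⟨f⟩_I` on the atom `I` of generation `n` that contains `x`. It is
meaningful where the average of `R` is positive definite. -/
def solve (𝒟 : AtomicFiltration σ) (R : X → E →L[ℝ] E) (f : X → E) (n : ℤ) (x : X) : E :=
  Ring.inverse (𝒟.avg n R x) (𝒟.avg n f x)

theorem stronglyMeasurable_solve (R : X → E →L[ℝ] E) (f : X → E) (n : ℤ) :
    StronglyMeasurable (solve 𝒟 R f n) :=
  stronglyMeasurable_comp_cell n fun I =>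
    Ring.inverse (⨍ x in I, R x ∂σ) (⨍ x in I, f x ∂σ)

theorem solve_eq {R : X → E →L[ℝ] E} {f : X → E} {n : ℤ} {I : Set X} (hI : I ∈ 𝒟.D n) {x y : X}
    (hx : x ∈ I) (hy : y ∈ I) : solve 𝒟 R f n x = solve 𝒟 R f n y := by
  rw [solve, solve, avg_eq hI hx, avg_eq hI hx, avg_eq hI hy, avg_eq hI hy]

/-- The value of the Bellman function on the atom of generation `n` that contains `x`. -/
def bellman (𝒟 : AtomicFiltration σ) (R : X → E →L[ℝ] E) (f : X → E) (n : ℤ) (x : X) : ℝ :=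
  inner ℝ (𝒟.avg n f x) (solve 𝒟 R f n x)

theorem stronglyMeasurable_bellman (R : X → E →L[ℝ] E) (f : X → E) (n : ℤ) :
    StronglyMeasurable (bellman 𝒟 R f n) :=
  (stronglyMeasurable_avg n f).inner (stronglyMeasurable_solve R f n)

variable [FiniteDimensional ℝ E]

theorem avg_solve {R : X → E →L[ℝ] E} {f : X → E} {n : ℤ} {x : X} (h : IsPosDef (𝒟.avg n R x)) :
    𝒟.avg n R x (solve 𝒟 R f n x) = 𝒟.avg n f x := by
  have hu : IsUnit (𝒟.avg n R x) :=
    ContinuousLinearMap.isUnit_iff_bijective.2 ⟨h.injective, h.surjective⟩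
  exact DFunLike.congr_fun (Ring.mul_inverse_cancel _ hu) (𝒟.avg n f x)

theorem isPosDef_avg {R : X → E →L[ℝ] E} (hR : LocInt 𝒟 R) (hpos : ∀ᵐ x ∂σ, IsPosDef (R x)) :
    ∀ᵐ x ∂σ, ∀ n, IsPosDef (𝒟.avg n R x) := by
  filter_upwards [ae_measure_cell_ne_zero (𝒟 := 𝒟)] with x hx n
  exact isPosDef_setAverage (hR ⟨n, _, 𝒟.cell_mem n x⟩) hpos (hx n)
    (measure_ne_top (𝒟.cell_mem n x))

theorem bellman_nonneg {R : X → E →L[ℝ] E} {f : X → E} {n : ℤ} {x : X}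
    (h : IsPosDef (𝒟.avg n R x)) : 0 ≤ bellman 𝒟 R f n x := by
  rw [bellman, ← avg_solve h]
  exact form_nonneg h.isPositive _

/-- Convexity of the Bellman function, with the gap: if the operator weight drops from `R + T` to
`R` in passing from an atom to its children, then the average of the Bellman function over the
children exceeds its value at the atom at least by the form of `T` and by the size of the weighted
martingale difference. -/
theorem bellman_step {n : ℤ} {R T : X → E →L[ℝ] E} {f : X → E} (hR : LocInt 𝒟 R)
    (hT : LocInt 𝒟 T) (hf : LocInt 𝒟 f) (hRpos : ∀ᵐ x ∂σ, IsPosDef (R x))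
    (hTpos : ∀ᵐ x ∂σ, (T x).IsPositive) {I : Set X} (hI : I ∈ 𝒟.D n) :
    ∫⁻ x in I, ENNReal.ofReal (form (T x) (solve 𝒟 (fun y => R y + T y) f n x) +
        form (𝒟.avg (n + 1) R x) (solve 𝒟 R f (n + 1) x - solve 𝒟 (fun y => R y + T y) f n x)) ∂σ +
      ∫⁻ x in I, ENNReal.ofReal (bellman 𝒟 (fun y => R y + T y) f n x) ∂σ ≤
    ∫⁻ x in I, ENNReal.ofReal (bellman 𝒟 R f (n + 1) x) ∂σ := by
  rcases I.eq_empty_or_nonempty with rfl | ⟨x₀, hx₀⟩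
  · simp
  by_cases hI0 : σ I = 0
  · simp [Measure.restrict_eq_zero.2 hI0]
  have hmI := measurableSet_of_mem hI
  have hRI : IntegrableOn R I σ := hR ⟨n, I, hI⟩
  have hTI : IntegrableOn T I σ := hT ⟨n, I, hI⟩
  have hfI : IntegrableOn f I σ := hf ⟨n, I, hI⟩
  have hI1 : MeasurableSet[𝒟.ℱ (n + 1)] I := measurableSet_of_mem_le (by lia) hI
  -- `c` is the constant value on `I` of the solution of generation `n`
  set c := solve 𝒟 (fun y => R y + T y) f n x₀ with hc
  have hcx : ∀ x ∈ I, solve 𝒟 (fun y => R y + T y) f n x = c := fun x hx => solve_eq hI hx hx₀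
  have hRTpos : ∀ᵐ x ∂σ, IsPosDef (R x + T x) := by
    filter_upwards [hRpos, hTpos] with x h1 h2 using h1.add_isPositive h2
  have hRTI : IntegrableOn (fun y => R y + T y) I σ := integrableOn_fun_add hRI hTI
  have hpd : IsPosDef (𝒟.avg n (fun y => R y + T y) x₀) := by
    rw [avg_eq hI hx₀]
    exact isPosDef_setAverage hRTI hRTpos hI0 (measure_ne_top hI)
  have hsol := avg_solve (f := f) hpd
  rw [avg_eq hI hx₀, avg_eq hI hx₀, ← hc] at hsol
  have hbx : ∀ x ∈ I, bellman 𝒟 (fun y => R y + T y) f n x = inner ℝ (⨍ y in I, f y ∂σ) c :=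
    fun x hx => by rw [bellman, hcx x hx, avg_eq hI hx]
  have hb0 : 0 ≤ inner ℝ (⨍ y in I, f y ∂σ) c := by
    rw [← hbx x₀ hx₀]
    exact bellman_nonneg hpd
  -- the affine minorant of the Bellman function that touches it at the atom `I`
  set ℓ : X → ℝ := fun x => 2 * inner ℝ c (𝒟.avg (n + 1) f x) - form (𝒟.avg (n + 1) R x) c with hℓ
  have hF' := integrableOn_avg hI1 hfI
  have hR' := integrableOn_avg hI1 hRI
  have hℓint : IntegrableOn ℓ I σ :=
    ((hF'.const_inner c).const_mul 2).sub (integrableOn_form hR' c)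
  have hℓval : ∫ x in I, ℓ x ∂σ =
      ∫ x in I, form (T x) c ∂σ + σ.real I * inner ℝ (⨍ y in I, f y ∂σ) c := by
    rw [hℓ, integral_sub ((hF'.const_inner c).const_mul 2) (integrableOn_form hR' c),
      integral_const_mul, integral_inner hF', setIntegral_form hR', setIntegral_avg hI1 hfI,
      setIntegral_avg hI1 hRI, ← setIntegral_form hRI]
    have h1 : ∫ x in I, form (R x) c ∂σ + ∫ x in I, form (T x) c ∂σ =
        σ.real I * inner ℝ (⨍ y in I, f y ∂σ) c := by
      rw [← integral_add (integrableOn_form hRI c) (integrableOn_form hTI c)]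
      simp_rw [← form_add_left]
      rw [setIntegral_form_eq hI hRTI, form, hsol]
    have h2 : inner ℝ c (∫ x in I, f x ∂σ) = σ.real I * inner ℝ (⨍ y in I, f y ∂σ) c := by
      rw [← measureReal_smul_setAverage hI, inner_smul_right, real_inner_comm]
    rw [h2]
    linarith
  have hpt : ∀ᵐ x ∂σ.restrict I, bellman 𝒟 R f (n + 1) x =
      form (𝒟.avg (n + 1) R x) (solve 𝒟 R f (n + 1) x - c) + ℓ x ∧
      0 ≤ form (𝒟.avg (n + 1) R x) (solve 𝒟 R f (n + 1) x - c) ∧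
      0 ≤ bellman 𝒟 R f (n + 1) x := by
    filter_upwards [ae_restrict_of_ae (isPosDef_avg hR hRpos)] with x hx
    have hs := avg_solve (f := f) (hx (n + 1))
    refine ⟨?_, form_nonneg (hx _).isPositive _, bellman_nonneg (hx _)⟩
    have h3 : inner ℝ (𝒟.avg (n + 1) R x c) (solve 𝒟 R f (n + 1) x) =
        inner ℝ (𝒟.avg (n + 1) f x) c := by
      rw [inner_symm_of_isPositive (hx _).isPositive, hs, real_inner_comm]
    simp only [hℓ, bellman, form, map_sub, hs, inner_sub_left, inner_sub_right, h3]
    rw [real_inner_comm c]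
    ring
  by_cases hfin : ∫⁻ x in I, ENNReal.ofReal (bellman 𝒟 R f (n + 1) x) ∂σ = ∞
  · rw [hfin]
    exact le_top
  have hbint : IntegrableOn (bellman 𝒟 R f (n + 1)) I σ :=
    (lintegral_ofReal_ne_top_iff_integrable
      (stronglyMeasurable_bellman R f (n + 1)).aestronglyMeasurable (hpt.mono fun x h => h.2.2)).1
      hfin
  have hgint : IntegrableOn
      (fun x => form (𝒟.avg (n + 1) R x) (solve 𝒟 R f (n + 1) x - c)) I σ := by
    refine (hbint.sub hℓint).congr ?_
    filter_upwards [hpt] with x hx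
    simp [hx.1]
  have hsum : IntegrableOn (fun x => form (T x) c +
      form (𝒟.avg (n + 1) R x) (solve 𝒟 R f (n + 1) x - c)) I σ :=
    (integrableOn_form hTI c).add hgint
  have hTn : ∀ᵐ x ∂σ.restrict I, 0 ≤ form (T x) c :=
    ae_restrict_of_ae (hTpos.mono fun x h => form_nonneg h c)
  have e1 : ∫⁻ x in I, ENNReal.ofReal (form (T x) (solve 𝒟 (fun y => R y + T y) f n x) +
      form (𝒟.avg (n + 1) R x)
        (solve 𝒟 R f (n + 1) x - solve 𝒟 (fun y => R y + T y) f n x)) ∂σ =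
      ∫⁻ x in I, ENNReal.ofReal (form (T x) c +
        form (𝒟.avg (n + 1) R x) (solve 𝒟 R f (n + 1) x - c)) ∂σ :=
    setLIntegral_congr_fun hmI fun x hx => by simp only [hcx x hx]
  have e2 : ∫⁻ x in I, ENNReal.ofReal (bellman 𝒟 (fun y => R y + T y) f n x) ∂σ =
      ∫⁻ _ in I, ENNReal.ofReal (inner ℝ (⨍ y in I, f y ∂σ) c) ∂σ :=
    setLIntegral_congr_fun hmI fun x hx => by simp only [hbx x hx]
  have hsn : 0 ≤ᵐ[σ.restrict I] fun x => form (T x) c +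
      form (𝒟.avg (n + 1) R x) (solve 𝒟 R f (n + 1) x - c) := by
    filter_upwards [hTn, hpt] with x h1 h2 using add_nonneg h1 h2.2.1
  have e3 : ∫⁻ _ in I, ENNReal.ofReal (inner ℝ (⨍ y in I, f y ∂σ) c) ∂σ =
      ENNReal.ofReal (σ.real I * inner ℝ (⨍ y in I, f y ∂σ) c) := by
    rw [setLIntegral_const, ENNReal.ofReal_mul measureReal_nonneg, mul_comm,
      ofReal_measureReal (measure_ne_top hI)]
  have e4 : ∫ x in I, bellman 𝒟 R f (n + 1) x ∂σ = ∫ x in I, (form (T x) c +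
      form (𝒟.avg (n + 1) R x) (solve 𝒟 R f (n + 1) x - c)) ∂σ +
      σ.real I * inner ℝ (⨍ y in I, f y ∂σ) c := by
    rw [integral_congr_ae (hpt.mono fun x h => h.1), integral_add hgint hℓint, hℓval,
      integral_add (integrableOn_form hTI c) hgint]
    ring
  rw [e1, e2, e3, ← ofReal_integral_eq_lintegral_ofReal hsum hsn,
    ← ofReal_integral_eq_lintegral_ofReal hbint (hpt.mono fun x h => h.2.2), e4,
    ENNReal.ofReal_add (integral_nonneg_of_ae hsn) (mul_nonneg measureReal_nonneg hb0)]

end Bellman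

end

/-! ### Functions that are constant on the atoms of one generation -/

section

open AtomicFiltration

variable {X : Type v} [MeasurableSpace X] {σ : Measure X} {𝒟 : AtomicFiltration σ}

/-- `g` is constant on every atom of generation `n`. -/
def CellConst {β : Type*} (𝒟 : AtomicFiltration σ) (n : ℤ) (g : X → β) : Prop :=
  ∀ I ∈ 𝒟.D n, ∀ x ∈ I, ∀ y ∈ I, g x = g y

theorem CellConst.mono {β : Type*} {n m : ℤ} (h : n ≤ m) {g : X → β} (hg : CellConst 𝒟 n g) :
    CellConst 𝒟 m g := by
  intro I hI x hx y hy
  refine hg _ (𝒟.cell_mem n x) x (𝒟.mem_cell n x) y ?_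
  have h1 := cell_subset (measurableSet_of_mem_le h (𝒟.cell_mem n x)) (𝒟.mem_cell n x)
  rw [cell_eq hI hx] at h1
  exact h1 hy

theorem CellConst.measurableSet {n : ℤ} {p : X → Prop} (hp : CellConst 𝒟 n p) :
    MeasurableSet[𝒟.ℱ n] {x | p x} := by
  have : {x | p x} = {x | 𝒟.cell n x ∈ {I | ∃ y ∈ I, I ∈ 𝒟.D n ∧ p y}} := by
    ext x
    simp only [Set.mem_ofPred_eq]
    constructor
    · intro h
      exact ⟨x, 𝒟.mem_cell n x, 𝒟.cell_mem n x, h⟩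
    · rintro ⟨y, hy, hI, h⟩
      rwa [hp _ hI x (𝒟.mem_cell n x) y hy]
  rw [this]
  exact measurableSet_cell_preimage n _

theorem cellConst_avg {E : Type*} [NormedAddCommGroup E] [NormedSpace ℝ E] (n : ℤ) (f : X → E) :
    CellConst 𝒟 n (𝒟.avg n f) := fun I hI x hx y hy => by
  rw [avg_eq hI hx, avg_eq hI hy]

variable {E : Type*} [NormedAddCommGroup E] [InnerProductSpace ℝ E]

theorem cellConst_solve (R : X → E →L[ℝ] E) (f : X → E) (n : ℤ) :
    CellConst 𝒟 n (solve 𝒟 R f n) := fun _ hI _ hx _ hy => solve_eq hI hx hy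

/-! ### Pairs of dual operator weights -/

/-- A pair of mutually inverse operator weights that satisfies the `A₂` condition with constant `A`.
The `A₂` condition is the bound `⟪⟨W⟩_I ⟨V⟩_I e, ⟨V⟩_I e⟫ ≤ A ⟪⟨V⟩_I e, e⟫`, which involves no
square roots. -/
structure IsWeightPair (𝒟 : AtomicFiltration σ) (V W : X → E →L[ℝ] E) (A : ℝ) : Prop where
  nonneg : 0 ≤ A
  locInt_left : LocInt 𝒟 V
  locInt_right : LocInt 𝒟 W
  posDef : ∀ᵐ x ∂σ, IsPosDef (V x)
  isPositive : ∀ᵐ x ∂σ, (W x).IsPositive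
  inverse : ∀ᵐ x ∂σ, ∀ e, V x (W x e) = e
  a2 : ∀ I : Atom 𝒟, ∀ e,
    form (⨍ x in I.set, W x ∂σ) ((⨍ x in I.set, V x ∂σ) e) ≤ A * form (⨍ x in I.set, V x ∂σ) e

variable {V W : X → E →L[ℝ] E} {A : ℝ}

variable [FiniteDimensional ℝ E]

theorem IsWeightPair.posDef_avg (h : IsWeightPair 𝒟 V W A) :
    ∀ᵐ x ∂σ, ∀ n, IsPosDef (𝒟.avg n V x) :=
  isPosDef_avg h.locInt_left h.posDef

/-- The `A₂` condition, applied on each atom with its own vector. -/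
theorem IsWeightPair.setLIntegral_le (h : IsWeightPair 𝒟 V W A) {n : ℤ} {S : Set X}
    (hS : MeasurableSet[𝒟.ℱ n] S) {y : X → E} (hy : CellConst 𝒟 n y) :
    ∫⁻ x in S, ENNReal.ofReal (form (W x) (𝒟.avg n V x (y x))) ∂σ ≤
      ENNReal.ofReal A * ∫⁻ x in S, ENNReal.ofReal (form (𝒟.avg n V x) (y x)) ∂σ := by
  rw [← lintegral_const_mul' _ _ ENNReal.ofReal_ne_top]
  refine setLIntegral_mono_of_atoms hS fun I hI _ => ?_
  rcases I.eq_empty_or_nonempty with rfl | ⟨x₀, hx₀⟩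
  · simp
  have hmI := measurableSet_of_mem hI
  have e1 : ∫⁻ x in I, ENNReal.ofReal (form (W x) (𝒟.avg n V x (y x))) ∂σ =
      ∫⁻ x in I, ENNReal.ofReal (form (W x) ((⨍ z in I, V z ∂σ) (y x₀))) ∂σ :=
    setLIntegral_congr_fun hmI fun x hx => by rw [avg_eq hI hx, hy I hI x hx x₀ hx₀]
  have e2 : ∫⁻ x in I, ENNReal.ofReal A * ENNReal.ofReal (form (𝒟.avg n V x) (y x)) ∂σ =
      ∫⁻ _ in I, ENNReal.ofReal (A * form (⨍ z in I, V z ∂σ) (y x₀)) ∂σ :=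
    setLIntegral_congr_fun hmI fun x hx => by
      rw [avg_eq hI hx, hy I hI x hx x₀ hx₀, ENNReal.ofReal_mul h.nonneg]
  rw [e1, e2, setLIntegral_form_eq hI (h.locInt_right ⟨n, I, hI⟩) h.isPositive,
    setLIntegral_const, ENNReal.ofReal_mul measureReal_nonneg,
    ofReal_measureReal (measure_ne_top hI), mul_comm]
  gcongr
  exact h.a2 ⟨n, I, hI⟩ _

theorem IsWeightPair.setLIntegral_avg_form (h : IsWeightPair 𝒟 V W A) {n : ℤ} {S : Set X}
    (hS : MeasurableSet[𝒟.ℱ n] S) (e : E) :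
    ∫⁻ x in S, ENNReal.ofReal (form (𝒟.avg n V x) e) ∂σ =
      ∫⁻ x in S, ENNReal.ofReal (form (V x) e) ∂σ := by
  have key : ∀ I ∈ 𝒟.D n, ∫⁻ x in I, ENNReal.ofReal (form (𝒟.avg n V x) e) ∂σ =
      ∫⁻ x in I, ENNReal.ofReal (form (V x) e) ∂σ := by
    intro I hI
    rw [setLIntegral_form_eq hI (h.locInt_left ⟨n, I, hI⟩) (h.posDef.mono fun _ h => h.isPositive),
      ENNReal.ofReal_mul measureReal_nonneg, ofReal_measureReal (measure_ne_top hI), mul_comm,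
      ← setLIntegral_const]
    exact setLIntegral_congr_fun (measurableSet_of_mem hI) fun x hx => by rw [avg_eq hI hx]
  exact le_antisymm (setLIntegral_mono_of_atoms hS fun I hI _ => (key I hI).le)
    (setLIntegral_mono_of_atoms hS fun I hI _ => (key I hI).ge)

/-! ### Telescoping the Bellman function -/

/-- The end of the telescoping: by convexity the Bellman function of the averages is at most the
average of its value `⟪f, V⁻¹ f⟫ = ⟪W f, f⟫`. -/
theorem IsWeightPair.setLIntegral_bellman_le (h : IsWeightPair 𝒟 V W A) {f : X → E}
    (hf : LocInt 𝒟 f) {n : ℤ} {S : Set X} (hS : MeasurableSet[𝒟.ℱ n] S) :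
    ∫⁻ x in S, ENNReal.ofReal (bellman 𝒟 V f n x) ∂σ ≤
      ∫⁻ x in S, ENNReal.ofReal (form (W x) (f x)) ∂σ := by
  refine setLIntegral_mono_of_atoms hS fun I hI _ => ?_
  rcases I.eq_empty_or_nonempty with rfl | ⟨x₀, hx₀⟩
  · simp
  by_cases hI0 : σ I = 0
  · simp [Measure.restrict_eq_zero.2 hI0]
  have hVI := h.locInt_left ⟨n, I, hI⟩
  have hWI := h.locInt_right ⟨n, I, hI⟩
  have hfI := hf ⟨n, I, hI⟩
  have hW0 : ∀ᵐ x ∂σ.restrict I, 0 ≤ form (W x) (f x) :=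
    ae_restrict_of_ae (h.isPositive.mono fun x hx => form_nonneg hx _)
  by_cases hfin : ∫⁻ x in I, ENNReal.ofReal (form (W x) (f x)) ∂σ = ∞
  · rw [hfin]
    exact le_top
  have hWf : IntegrableOn (fun x => form (W x) (f x)) I σ :=
    (lintegral_ofReal_ne_top_iff_integrable
      (continuous_form.comp_aestronglyMeasurable
        (hWI.aestronglyMeasurable.prodMk hfI.aestronglyMeasurable)) hW0).1 hfin
  have hpd : IsPosDef (𝒟.avg n V x₀) := by
    rw [avg_eq hI hx₀]
    exact isPosDef_setAverage hVI h.posDef hI0 (measure_ne_top hI)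
  set c := solve 𝒟 V f n x₀ with hc
  have hsol := avg_solve (f := f) hpd
  rw [avg_eq hI hx₀, avg_eq hI hx₀, ← hc] at hsol
  have e1 : ∫⁻ x in I, ENNReal.ofReal (bellman 𝒟 V f n x) ∂σ =
      ∫⁻ _ in I, ENNReal.ofReal (inner ℝ (⨍ y in I, f y ∂σ) c) ∂σ :=
    setLIntegral_congr_fun (measurableSet_of_mem hI) fun x hx => by
      rw [bellman, avg_eq hI hx, solve_eq hI hx hx₀]
  rw [e1, setLIntegral_const, ← ofReal_integral_eq_lintegral_ofReal hWf hW0,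
    ← ofReal_measureReal (measure_ne_top hI), mul_comm, ← ENNReal.ofReal_mul measureReal_nonneg]
  refine ENNReal.ofReal_le_ofReal ?_
  have hint := (hfI.const_inner (𝕜 := ℝ) c).const_mul 2
  have e2 : σ.real I * inner ℝ (⨍ y in I, f y ∂σ) c =
      ∫ x in I, (2 * inner ℝ c (f x) - form (V x) c) ∂σ := by
    rw [integral_sub hint (integrableOn_form hVI c), integral_const_mul, integral_inner hfI,
      setIntegral_form_eq hI hVI, form, hsol, ← measureReal_smul_setAverage hI, inner_smul_right,
      real_inner_comm c]
    ring
  rw [e2]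
  refine integral_mono_ae (hint.sub (integrableOn_form hVI c)) hWf ?_
  filter_upwards [ae_restrict_of_ae h.posDef, ae_restrict_of_ae h.inverse] with x hx hinv
  have h1 := form_nonneg hx.isPositive (c - W x (f x))
  have h2 : inner ℝ (V x c) (W x (f x)) = inner ℝ c (f x) := by
    rw [inner_symm_of_isPositive hx.isPositive, hinv]
  simp only [form, map_sub, inner_sub_left, inner_sub_right, hinv, h2] at h1 ⊢
  rw [real_inner_comm (f x) c, real_inner_comm (f x) (W x (f x))] at *
  linarith

theorem sum_add_le_of_step {N : ℕ} {g b : ℕ → ℝ≥0∞} (h : ∀ k < N, g k + b k ≤ b (k + 1)) :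
    ∑ k ∈ Finset.range N, g k + b 0 ≤ b N := by
  induction N with
  | zero => simp
  | succ N ih =>
    rw [Finset.sum_range_succ]
    calc _ = g N + (∑ k ∈ Finset.range N, g k + b 0) := by ring
      _ ≤ g N + b N := by gcongr; exact ih fun k hk => h k (by lia)
      _ ≤ _ := h N (by lia)

/-- Along a decreasing sequence of operator weights `V = R N ≤ … ≤ R 0`, where the passage from
generation `a + k` to the next one lowers the weight by `T k`, the gaps in the convexity of the
Bellman function add up to at most the weighted norm of `f`. -/
theorem IsWeightPair.sum_bellman_le (h : IsWeightPair 𝒟 V W A) {f : X → E} (hf : LocInt 𝒟 f)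
    {a : ℤ} {N : ℕ} {R T : ℕ → X → E →L[ℝ] E} (hRN : R N = V)
    (hRT : ∀ k < N, R k = fun x => R (k + 1) x + T k x)
    (hR : ∀ k, LocInt 𝒟 (R k)) (hT : ∀ k, LocInt 𝒟 (T k))
    (hRpos : ∀ k, ∀ᵐ x ∂σ, IsPosDef (R k x)) (hTpos : ∀ k, ∀ᵐ x ∂σ, (T k x).IsPositive)
    {J : Set X} (hJ : J ∈ 𝒟.D a) :
    ∑ k ∈ Finset.range N, ∫⁻ x in J, ENNReal.ofReal (form (T k x) (solve 𝒟 (R k) f (a + k) x) +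
        form (𝒟.avg (a + k + 1) (R (k + 1)) x)
          (solve 𝒟 (R (k + 1)) f (a + k + 1) x - solve 𝒟 (R k) f (a + k) x)) ∂σ ≤
      ∫⁻ x in J, ENNReal.ofReal (form (W x) (f x)) ∂σ := by
  have hmeas : ∀ n : ℕ, MeasurableSet[𝒟.ℱ (a + n)] J := fun n =>
    measurableSet_of_mem_le (by lia) hJ
  have key := sum_add_le_of_step (N := N)
    (g := fun k => ∫⁻ x in J, ENNReal.ofReal (form (T k x) (solve 𝒟 (R k) f (a + k) x) +
        form (𝒟.avg (a + k + 1) (R (k + 1)) x)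
          (solve 𝒟 (R (k + 1)) f (a + k + 1) x - solve 𝒟 (R k) f (a + k) x)) ∂σ)
    (b := fun k => ∫⁻ x in J, ENNReal.ofReal (bellman 𝒟 (R k) f (a + k) x) ∂σ) (by
      intro k hk
      have hb : Measurable fun x => ENNReal.ofReal (bellman 𝒟 (R k) f (a + k) x) :=
        (stronglyMeasurable_bellman (R k) f (a + k)).measurable.ennreal_ofReal
      rw [← lintegral_add_right _ hb, Nat.cast_add, Nat.cast_one, ← add_assoc]
      refine setLIntegral_mono_of_atoms (hmeas k) fun I hI _ => ?_
      rw [lintegral_add_right _ hb, hRT k hk]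
      exact bellman_step (hR (k + 1)) (hT k) hf (hRpos (k + 1)) (hTpos k) hI)
  refine (le_self_add.trans key).trans ?_
  rw [hRN]
  exact h.setLIntegral_bellman_le hf (hmeas N)

end

/-! ### A stopping time for the square function of a martingale -/

section

open AtomicFiltration

variable {X : Type v} [MeasurableSpace X] {σ : Measure X} {𝒟 : AtomicFiltration σ}

section Stopping

variable {H : Type*} [NormedAddCommGroup H] [InnerProductSpace ℝ H]

/-- The square of the square function of `f`, over `n` generations starting from generation `a`. -/
def sqSum (𝒟 : AtomicFiltration σ) (a : ℤ) (f : X → H) (n : ℕ) (x : X) : ℝ :=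
  ∑ i ∈ Finset.range n, ‖𝒟.avg (a + (i + 1 : ℕ)) f x - 𝒟.avg (a + i) f x‖ ^ 2

/-- The points of `J` at which, up to generation `a + n`, neither the martingale of `f` has exceeded
`r` nor its square function `√5 r`. -/
def aliveSet (𝒟 : AtomicFiltration σ) (a : ℤ) (f : X → H) (r : ℝ) (J : Set X) (n : ℕ) : Set X :=
  {x | x ∈ J ∧ ∀ j ≤ n, ‖𝒟.avg (a + j) f x‖ ≤ r ∧ sqSum 𝒟 a f j x ≤ 5 * r ^ 2}

variable {a : ℤ} {f : X → H} {r : ℝ} {J : Set X}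

theorem sqSum_nonneg (n : ℕ) (x : X) : 0 ≤ sqSum 𝒟 a f n x :=
  Finset.sum_nonneg fun _ _ => sq_nonneg _

theorem sqSum_succ (n : ℕ) (x : X) : sqSum 𝒟 a f (n + 1) x = sqSum 𝒟 a f n x +
    ‖𝒟.avg (a + (n + 1 : ℕ)) f x - 𝒟.avg (a + n) f x‖ ^ 2 :=
  Finset.sum_range_succ _ _

theorem aliveSet_subset (n : ℕ) : aliveSet 𝒟 a f r J n ⊆ J := fun _ h => h.1

theorem aliveSet_succ_subset (n : ℕ) : aliveSet 𝒟 a f r J (n + 1) ⊆ aliveSet 𝒟 a f r J n :=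
  fun _ h => ⟨h.1, fun j hj => h.2 j (by lia)⟩

theorem norm_avg_le_of_mem_aliveSet {n : ℕ} {x : X} (h : x ∈ aliveSet 𝒟 a f r J n) :
    ‖𝒟.avg (a + n) f x‖ ≤ r := (h.2 n le_rfl).1

theorem cellConst_sqSum (n : ℕ) : CellConst 𝒟 (a + n) (sqSum 𝒟 a f n) := by
  intro I hI x hx y hy
  refine Finset.sum_congr rfl fun i hi => ?_
  have hi' := Finset.mem_range.1 hi
  have h (j : ℕ) (hj : j ≤ n) : 𝒟.avg (a + j) f x = 𝒟.avg (a + j) f y :=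
    (cellConst_avg (𝒟 := 𝒟) (a + j) f).mono (by lia) I hI x hx y hy
  rw [h _ (by lia), h _ (by lia)]

theorem measurableSet_aliveSet (hJ : J ∈ 𝒟.D a) (n : ℕ) :
    MeasurableSet[𝒟.ℱ (a + n)] (aliveSet 𝒟 a f r J n) := by
  refine MeasurableSet.inter (measurableSet_of_mem_le (by lia) hJ)
    (CellConst.measurableSet fun I hI x hx y hy => ?_)
  have h1 (j : ℕ) (hj : j ≤ n) : 𝒟.avg (a + j) f x = 𝒟.avg (a + j) f y :=
    (cellConst_avg (𝒟 := 𝒟) (a + j) f).mono (by lia) I hI x hx y hy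
  have h2 (j : ℕ) (hj : j ≤ n) : sqSum 𝒟 a f j x = sqSum 𝒟 a f j y :=
    (cellConst_sqSum (𝒟 := 𝒟) (a := a) (f := f) j).mono (by lia) I hI x hx y hy
  refine propext (forall₂_congr fun j hj => ?_)
  rw [h1 j hj, h2 j hj]

theorem measurableSet_aliveSet' (hJ : J ∈ 𝒟.D a) (n : ℕ) :
    MeasurableSet (aliveSet 𝒟 a f r J n) := 𝒟.ℱ.le _ _ (measurableSet_aliveSet hJ n)

/-- The martingale property: `h` of generation `n` is orthogonal to the next difference. -/
theorem setIntegral_inner_avg [CompleteSpace H] {n : ℤ} {S : Set X}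
    (hS : MeasurableSet[𝒟.ℱ n] S) (hf : IntegrableOn f S σ)
    (h1 : IntegrableOn (fun x => inner ℝ (𝒟.avg n f x) (𝒟.avg (n + 1) f x)) S σ)
    (h2 : IntegrableOn (fun x => ‖𝒟.avg n f x‖ ^ 2) S σ) :
    ∫ x in S, inner ℝ (𝒟.avg n f x) (𝒟.avg (n + 1) f x) ∂σ = ∫ x in S, ‖𝒟.avg n f x‖ ^ 2 ∂σ := by
  refine setIntegral_congr_of_atoms hS h1 h2 fun I hI hIS => ?_
  have hmI := measurableSet_of_mem hI
  have hfI := hf.mono_set hIS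
  have hI1 : MeasurableSet[𝒟.ℱ (n + 1)] I := measurableSet_of_mem_le (by lia) hI
  have e1 : ∫ x in I, inner ℝ (𝒟.avg n f x) (𝒟.avg (n + 1) f x) ∂σ =
      ∫ x in I, inner ℝ (⨍ y in I, f y ∂σ) (𝒟.avg (n + 1) f x) ∂σ :=
    setIntegral_congr_fun hmI fun x hx => by simp only [avg_eq hI hx]
  have e2 : ∫ x in I, ‖𝒟.avg n f x‖ ^ 2 ∂σ =
      ∫ _ in I, inner ℝ (⨍ y in I, f y ∂σ) (⨍ y in I, f y ∂σ) ∂σ :=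
    setIntegral_congr_fun hmI fun x hx => by
      simp only [avg_eq hI hx, real_inner_self_eq_norm_sq]
  rw [e1, e2, integral_inner (integrableOn_avg hI1 hfI), setIntegral_avg hI1 hfI,
    setIntegral_const, ← measureReal_smul_setAverage hI, inner_smul_right, smul_eq_mul]

theorem setIntegral_norm_avg_le {n : ℤ} {S : Set X} (hS : MeasurableSet[𝒟.ℱ n] S)
    (hf : IntegrableOn f S σ) : ∫ x in S, ‖𝒟.avg n f x‖ ∂σ ≤ ∫ x in S, ‖f x‖ ∂σ := by
  rw [integral_norm_eq_lintegral_enorm (integrableOn_avg hS hf).aestronglyMeasurable,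
    integral_norm_eq_lintegral_enorm hf.aestronglyMeasurable]
  exact ENNReal.toReal_mono hf.2.ne (setLIntegral_avg_le hS f)

theorem integrableOn_of_norm_le {g : X → ℝ} {S : Set X} (hS : MeasurableSet S) (hσ : σ S ≠ ∞)
    (hg : StronglyMeasurable g) {C : ℝ} (h : ∀ x ∈ S, ‖g x‖ ≤ C) : IntegrableOn g S σ :=
  Measure.integrableOn_of_bounded hσ hg.aestronglyMeasurable
    ((ae_restrict_iff' hS).2 (Filter.Eventually.of_forall h))

theorem stronglyMeasurable_sqSum (n : ℕ) : StronglyMeasurable (sqSum 𝒟 a f n) :=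
  Finset.stronglyMeasurable_fun_sum _ fun _ _ =>
    ((stronglyMeasurable_avg _ f).sub (stronglyMeasurable_avg _ f)).norm.pow 2

/-- The weak type estimate behind the stopping time, in the form of a potential that does not
increase from one generation to the next. -/
theorem stopping_potential_le [CompleteSpace H] (hJ : J ∈ 𝒟.D a) (hf : IntegrableOn f J σ)
    (hr : 0 ≤ r) (h0 : ∀ x ∈ J, ‖𝒟.avg a f x‖ ≤ r) (n : ℕ) :
    r ^ 2 * σ.real (J \ aliveSet 𝒟 a f r J n) + ∫ x in aliveSet 𝒟 a f r J n, sqSum 𝒟 a f n x ∂σ -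
        ∫ x in aliveSet 𝒟 a f r J n, ‖𝒟.avg (a + n) f x‖ ^ 2 ∂σ ≤
      3 * r * ∫ x in J \ aliveSet 𝒟 a f r J n, ‖f x‖ ∂σ := by
  have hmJ := measurableSet_of_mem hJ
  have hσJ := measure_ne_top hJ
  induction n with
  | zero =>
    have hS : aliveSet 𝒟 a f r J 0 = J := by
      refine Set.Subset.antisymm (aliveSet_subset 0) fun x hx => ⟨hx, fun j hj => ?_⟩
      obtain rfl : j = 0 := by lia
      simp only [Nat.cast_zero, add_zero, sqSum, Finset.range_zero, Finset.sum_empty]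
      exact ⟨h0 x hx, by positivity⟩
    have h1 : 0 ≤ ∫ x in J, ‖𝒟.avg a f x‖ ^ 2 ∂σ := integral_nonneg fun _ => sq_nonneg _
    simp [hS, sqSum, h1]
  | succ n ih =>
    set S := aliveSet 𝒟 a f r J n with hSdef
    set S' := aliveSet 𝒟 a f r J (n + 1) with hS'def
    have hSJ : S ⊆ J := aliveSet_subset n
    have hS'S : S' ⊆ S := aliveSet_succ_subset n
    have hmS : MeasurableSet S := measurableSet_aliveSet' hJ n
    have hmS' : MeasurableSet S' := measurableSet_aliveSet' hJ (n + 1)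
    have hcast : a + ((n + 1 : ℕ) : ℤ) = a + n + 1 := by push_cast; ring
    have hS1 : MeasurableSet[𝒟.ℱ (a + n + 1)] S :=
      𝒟.ℱ.mono (by lia) _ (measurableSet_aliveSet hJ n)
    have hS'1 : MeasurableSet[𝒟.ℱ (a + n + 1)] S' := hcast ▸ measurableSet_aliveSet hJ (n + 1)
    have hfin (B : Set X) (hB : B ⊆ J) : σ B ≠ ∞ := measure_ne_top_of_subset hB hσJ
    have hZJ : S \ S' ⊆ J := Set.sdiff_subset.trans hSJ
    have hfS := hf.mono_set hSJ
    have hfZ : IntegrableOn (fun x => ‖f x‖) (S \ S') σ := (hf.mono_set hZJ).norm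
    set h := 𝒟.avg (a + n) f with hh
    set h' := 𝒟.avg (a + n + 1) f with hh'
    set Q := sqSum 𝒟 a f n with hQ
    have hQ' : ∀ x, sqSum 𝒟 a f (n + 1) x = Q x + ‖h' x - h x‖ ^ 2 := fun x => by
      rw [sqSum_succ, hcast]
    have hhm : StronglyMeasurable h := stronglyMeasurable_avg _ f
    have hh'm : StronglyMeasurable h' := stronglyMeasurable_avg _ f
    have hhS : ∀ x ∈ S, ‖h x‖ ≤ r := fun x hx => norm_avg_le_of_mem_aliveSet hx
    have hh'S : ∀ x ∈ S', ‖h' x‖ ≤ r := fun x hx => by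
      have := norm_avg_le_of_mem_aliveSet hx
      rwa [hcast] at this
    have hQS : ∀ x ∈ S, Q x ≤ 5 * r ^ 2 := fun x hx => (hx.2 n le_rfl).2
    have hsq (u : H) (hu : ‖u‖ ≤ r) : ‖(‖u‖ ^ 2 : ℝ)‖ ≤ r ^ 2 := by
      rw [Real.norm_of_nonneg (by positivity)]
      gcongr
    -- integrability
    have i1 : IntegrableOn (fun x => ‖h x‖ ^ 2) S σ :=
      integrableOn_of_norm_le hmS (hfin S hSJ) (hhm.norm.pow 2) (C := r ^ 2)
        fun x hx => hsq _ (hhS x hx)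
    have i2 : IntegrableOn (fun x => ‖h' x‖ ^ 2) S' σ :=
      integrableOn_of_norm_le hmS' (hfin S' (hS'S.trans hSJ)) (hh'm.norm.pow 2) (C := r ^ 2)
        fun x hx => hsq _ (hh'S x hx)
    have i3 : IntegrableOn Q S σ :=
      integrableOn_of_norm_le hmS (hfin S hSJ) (stronglyMeasurable_sqSum n) (C := 5 * r ^ 2)
        fun x hx => by rw [Real.norm_of_nonneg (sqSum_nonneg n x)]; exact hQS x hx
    have ih' : IntegrableOn h' S σ := integrableOn_avg hS1 hfS
    have i4 : IntegrableOn (fun x => inner ℝ (h x) (h' x)) S σ := by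
      refine Integrable.mono' (ih'.norm.const_mul r)
        (hhm.inner hh'm).aestronglyMeasurable ((ae_restrict_iff' hmS).2 (.of_forall fun x hx => ?_))
      exact (norm_inner_le_norm _ _).trans (by gcongr; exact hhS x hx)
    set φ : X → ℝ := fun x => 2 * inner ℝ (h x) (h' x) - ‖h x‖ ^ 2 with hφ
    have iφ : IntegrableOn φ S σ := (i4.const_mul 2).sub i1
    have hφS : ∫ x in S, φ x ∂σ = ∫ x in S, ‖h x‖ ^ 2 ∂σ := by
      rw [hφ, integral_sub (i4.const_mul 2) i1, integral_const_mul,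
        setIntegral_inner_avg (measurableSet_aliveSet hJ n) hfS i4 i1]
      ring
    have hsplit (g : X → ℝ) (hg : IntegrableOn g S σ) :
        ∫ x in S', g x ∂σ + ∫ x in S \ S', g x ∂σ = ∫ x in S, g x ∂σ :=
      integral_inter_add_sdiff hmS' hg ▸ by rw [Set.inter_eq_right.2 hS'S]
    have iZn : IntegrableOn (fun x => ‖h' x‖) (S \ S') σ := (ih'.mono_set Set.sdiff_subset).norm
    have hZh' : ∫ x in S \ S', ‖h' x‖ ∂σ ≤ ∫ x in S \ S', ‖f x‖ ∂σ :=
      setIntegral_norm_avg_le (hS1.diff hS'1) (hf.mono_set hZJ)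
    -- the cross term on the set where the martingale stops
    have hφZ : ∫ x in S \ S', φ x ∂σ ≤ 2 * r * ∫ x in S \ S', ‖f x‖ ∂σ := by
      calc ∫ x in S \ S', φ x ∂σ ≤ ∫ x in S \ S', 2 * r * ‖h' x‖ ∂σ := by
            refine setIntegral_mono_on (iφ.mono_set Set.sdiff_subset) (iZn.const_mul _)
              (hmS.diff hmS') fun x hx => ?_
            have h1 := real_inner_le_norm (h x) (h' x)
            have h2 : ‖h x‖ * ‖h' x‖ ≤ r * ‖h' x‖ := by gcongr; exact hhS x hx.1
            simp only [hφ]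
            nlinarith [sq_nonneg ‖h x‖]
        _ = 2 * r * ∫ x in S \ S', ‖h' x‖ ∂σ := integral_const_mul _ _
        _ ≤ _ := by gcongr
    -- where the martingale stops, its new norm exceeds `r`, or else the last jump is at most `2 r`
    -- and the square function, now above `√5 r`, was at least `r` before that jump
    have hlost : r ^ 2 * σ.real (S \ S') ≤
        ∫ x in S \ S', Q x ∂σ + r * ∫ x in S \ S', ‖f x‖ ∂σ := by
      calc r ^ 2 * σ.real (S \ S') = ∫ _ in S \ S', r ^ 2 ∂σ := by
            rw [setIntegral_const, smul_eq_mul, mul_comm]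
        _ ≤ ∫ x in S \ S', (Q x + r * ‖h' x‖) ∂σ := by
            refine setIntegral_mono_on (integrableOn_const (hfin _ hZJ))
              ((i3.mono_set Set.sdiff_subset).add (iZn.const_mul r)) (hmS.diff hmS') fun x hx => ?_
            have hQ0 : 0 ≤ Q x := sqSum_nonneg n x
            by_cases hn : ‖h' x‖ ≤ r
            · have hlarge : 5 * r ^ 2 < Q x + ‖h' x - h x‖ ^ 2 := by
                by_contra hcon
                refine hx.2 ⟨hx.1.1, fun j hj => ?_⟩
                rcases Nat.lt_or_ge n j with hjn | hjn
                · obtain rfl : j = n + 1 := by lia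
                  rw [hcast, hQ']
                  exact ⟨hn, not_lt.1 hcon⟩
                · exact hx.1.2 j hjn
              have h1 : ‖h' x - h x‖ ≤ 2 * r := by
                have := norm_sub_le (h' x) (h x)
                have := hhS x hx.1
                linarith
              have h2 : ‖h' x - h x‖ ^ 2 ≤ (2 * r) ^ 2 := by gcongr
              have h3 : 0 ≤ r * ‖h' x‖ := by positivity
              nlinarith
            · have : r * r ≤ r * ‖h' x‖ := by gcongr; exact (not_le.1 hn).le
              nlinarith
        _ = ∫ x in S \ S', Q x ∂σ + r * ∫ x in S \ S', ‖h' x‖ ∂σ := by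
            rw [integral_add (i3.mono_set Set.sdiff_subset) (iZn.const_mul r), integral_const_mul]
        _ ≤ _ := by gcongr
    have iQ' := i3.mono_set hS'S
    have hQS' : ∫ x in S', sqSum 𝒟 a f (n + 1) x ∂σ =
        ∫ x in S', Q x ∂σ + (∫ x in S', ‖h' x‖ ^ 2 ∂σ - ∫ x in S', φ x ∂σ) := by
      have i5 : IntegrableOn (fun x => ‖h' x‖ ^ 2 - φ x) S' σ := i2.sub (iφ.mono_set hS'S)
      rw [← integral_sub i2 (iφ.mono_set hS'S), ← integral_add iQ' i5]
      refine setIntegral_congr_fun hmS' fun x _ => ?_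
      simp only [hQ', hφ]
      rw [norm_sub_sq_real, real_inner_comm]
      ring
    have hJS' : J \ S' = (J \ S) ∪ (S \ S') := by
      ext x
      simp only [Set.mem_sdiff, Set.mem_union]
      constructor
      · rintro ⟨h1, h2⟩
        by_cases h3 : x ∈ S
        · exact .inr ⟨h3, h2⟩
        · exact .inl ⟨h1, h3⟩
      · rintro (⟨h1, h2⟩ | ⟨h1, h2⟩)
        · exact ⟨h1, fun h3 => h2 (hS'S h3)⟩
        · exact ⟨hSJ h1, h2⟩
    have hdisj : Disjoint (J \ S) (S \ S') :=
      Set.disjoint_left.2 fun x h1 h2 => h1.2 h2.1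
    have e1 : σ.real (J \ S') = σ.real (J \ S) + σ.real (S \ S') := by
      rw [hJS', measureReal_union hdisj (hmS.diff hmS') (hfin _ Set.sdiff_subset) (hfin _ hZJ)]
    have e2 : ∫ x in J \ S', ‖f x‖ ∂σ = ∫ x in J \ S, ‖f x‖ ∂σ + ∫ x in S \ S', ‖f x‖ ∂σ := by
      rw [hJS', setIntegral_union hdisj (hmS.diff hmS') (hf.mono_set Set.sdiff_subset).norm hfZ]
    have s1 := hsplit Q i3
    have s2 := hsplit φ iφ
    rw [hQS', e1, e2, hcast]
    linarith

/-- If `r` is six times the average of `‖f‖`, then at least half of `J` is never stopped. -/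
theorem measureReal_le_two_mul_aliveSet [CompleteSpace H] (hJ : J ∈ 𝒟.D a)
    (hf : IntegrableOn f J σ) (hr : 0 < r) (hfr : 6 * ∫ x in J, ‖f x‖ ∂σ ≤ r * σ.real J) (n : ℕ) :
    σ.real J ≤ 2 * σ.real (aliveSet 𝒟 a f r J n) := by
  have hσJ := measure_ne_top hJ
  by_cases hJ0 : σ.real J = 0
  · rw [hJ0]; positivity
  have hJpos : 0 < σ.real J := lt_of_le_of_ne measureReal_nonneg (Ne.symm hJ0)
  have hI0 : 0 ≤ ∫ x in J, ‖f x‖ ∂σ := integral_nonneg fun _ => norm_nonneg _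
  have h0 : ∀ x ∈ J, ‖𝒟.avg a f x‖ ≤ r := by
    intro x hx
    rw [avg_eq hJ hx, setAverage_eq, norm_smul, norm_inv, Real.norm_of_nonneg hJpos.le,
      inv_mul_le_iff₀ hJpos]
    have := norm_integral_le_integral_norm (μ := σ.restrict J) f
    linarith
  have key := stopping_potential_le hJ hf hr.le h0 n
  set S := aliveSet 𝒟 a f r J n with hS
  have hSJ : S ⊆ J := aliveSet_subset n
  have hmS : MeasurableSet S := measurableSet_aliveSet' hJ n
  have hfS := hf.mono_set hSJ
  have hSn := measurableSet_aliveSet (f := f) (r := r) hJ n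
  have h1 : 0 ≤ ∫ x in S, sqSum 𝒟 a f n x ∂σ := integral_nonneg fun x => sqSum_nonneg n x
  have h2 : ∫ x in S, ‖𝒟.avg (a + n) f x‖ ^ 2 ∂σ ≤ r * ∫ x in S, ‖f x‖ ∂σ := by
    calc _ ≤ ∫ x in S, r * ‖𝒟.avg (a + n) f x‖ ∂σ := by
          have i1 : IntegrableOn (fun x => r * ‖𝒟.avg (a + n) f x‖) S σ :=
            (integrableOn_avg hSn hfS).norm.const_mul r
          have hle : ∀ x ∈ S, ‖𝒟.avg (a + n) f x‖ ^ 2 ≤ r * ‖𝒟.avg (a + n) f x‖ := fun x hx => by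
            rw [sq]
            gcongr
            exact norm_avg_le_of_mem_aliveSet hx
          refine setIntegral_mono_on (Integrable.mono' i1
            ((stronglyMeasurable_avg _ f).norm.pow 2).aestronglyMeasurable
            ((ae_restrict_iff' hmS).2 (.of_forall fun x hx => ?_))) i1 hmS hle
          simpa using hle x hx
      _ = r * ∫ x in S, ‖𝒟.avg (a + n) f x‖ ∂σ := integral_const_mul _ _
      _ ≤ _ := mul_le_mul_of_nonneg_left (setIntegral_norm_avg_le hSn hfS) hr.le
  have h3 : ∫ x in S, ‖f x‖ ∂σ + ∫ x in J \ S, ‖f x‖ ∂σ = ∫ x in J, ‖f x‖ ∂σ := by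
    have := integral_inter_add_sdiff hmS hf.norm
    rwa [Set.inter_eq_right.2 hSJ] at this
  have h4 : 0 ≤ ∫ x in S, ‖f x‖ ∂σ := integral_nonneg fun _ => norm_nonneg _
  have h5 : σ.real (J \ S) = σ.real J - σ.real S :=
    measureReal_sdiff hSJ hmS hσJ
  have h6 : r ^ 2 * σ.real (J \ S) ≤ 3 * r * ∫ x in J, ‖f x‖ ∂σ := by
    have : 0 ≤ r * ∫ x in S, ‖f x‖ ∂σ := by positivity
    rw [← h3]
    linarith
  have h7 : r * (r * σ.real (J \ S)) ≤ r * (r * σ.real J / 2) := by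
    have : r * (6 * ∫ x in J, ‖f x‖ ∂σ) ≤ r * (r * σ.real J) := by gcongr
    linarith
  have h8 := le_of_mul_le_mul_left h7 hr
  have h9 : r * σ.real (J \ S) ≤ r * (σ.real J / 2) := by linarith
  have h10 := le_of_mul_le_mul_left h9 hr
  linarith

end Stopping

end

/-! ### The testing condition -/

section

open AtomicFiltration

variable {X : Type v} [MeasurableSpace X] {σ : Measure X} {𝒟 : AtomicFiltration σ}

theorem localMax_mono {I J : Atom 𝒟} (h : I ∈ J.descendants) (w : X → ℝ) (x : X) :
    localMax I w x ≤ localMax J w x := by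
  refine iSup_le fun I' => iSup_le fun hI' => iSup_le fun hx => ?_
  have : I' ∈ J.descendants := ⟨hI'.1.trans h.1, h.2.trans hI'.2⟩
  exact le_iSup_of_le I' (le_iSup_of_le this (le_iSup_of_le hx le_rfl))

theorem enorm_average_le_localMax (J : Atom 𝒟) (w : X → ℝ) {x : X} (hx : x ∈ J.set) :
    ‖⨍ y in J.set, w y ∂σ‖ₑ ≤ localMax J w x :=
  le_iSup_of_le J (le_iSup_of_le ⟨subset_rfl, le_rfl⟩ (le_iSup_of_le hx le_rfl))

/-- Decomposition of an integral according to the time at which a decreasing sequence of sets is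
left. -/
theorem setLIntegral_eq_add_sum_sdiff {S : ℕ → Set X} (hS : ∀ n, MeasurableSet (S n))
    (hanti : ∀ n, S (n + 1) ⊆ S n) (φ : X → ℝ≥0∞) (m : ℕ) :
    ∫⁻ x in S 0, φ x ∂σ =
      ∫⁻ x in S m, φ x ∂σ + ∑ j ∈ Finset.range m, ∫⁻ x in S j \ S (j + 1), φ x ∂σ := by
  induction m with
  | zero => simp
  | succ m ih =>
    have h := lintegral_inter_add_sdiff (μ := σ) φ (S m) (hS (m + 1))
    rw [Set.inter_eq_right.2 (hanti m)] at h
    rw [ih, ← h, Finset.sum_range_succ]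
    ring

variable {E : Type*} [NormedAddCommGroup E] [InnerProductSpace ℝ E]

/-- The pointwise sum that defines the weighted square function of `V e`, over `m` generations
starting from generation `a`. -/
def testSum (𝒟 : AtomicFiltration σ) (V W : X → E →L[ℝ] E) (e : E) (a : ℤ) (m : ℕ) (x : X) :
    ℝ≥0∞ :=
  ∑ j ∈ Finset.range m, ENNReal.ofReal
    (form (W x) ((𝒟.avg (a + (j + 1 : ℕ)) V x - 𝒟.avg (a + j) V x) e))

theorem testSum_add (V W : X → E →L[ℝ] E) (e : E) (a : ℤ) (m n : ℕ) (x : X) :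
    testSum 𝒟 V W e a (m + n) x = testSum 𝒟 V W e a m x + testSum 𝒟 V W e (a + m) n x := by
  unfold testSum
  rw [Finset.sum_range_add]
  congr 1
  refine Finset.sum_congr rfl fun j _ => ?_
  have h1 : a + ((m + j + 1 : ℕ) : ℤ) = a + m + ((j + 1 : ℕ) : ℤ) := by push_cast; ring
  have h2 : a + ((m + j : ℕ) : ℤ) = a + m + (j : ℤ) := by push_cast; ring
  rw [h1, h2]

/-- The dimensional constant of the testing condition. -/
def testConst (D : ℕ) : ℝ := 2 * (7 * 2 ^ D * (36 * (D + 1) ^ 2) * D + 2)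

theorem testConst_nonneg (D : ℕ) : 0 ≤ testConst D := by unfold testConst; positivity

variable {V W : X → E →L[ℝ] E} {A : ℝ}

/-- Coordinates with respect to the dual basis of `c`. -/
def coordCLM {D : ℕ} (c : Fin D → E) : E →L[ℝ] EuclideanSpace ℝ (Fin D) :=
  (EuclideanSpace.equiv (Fin D) ℝ).symm.toContinuousLinearMap.comp
    (ContinuousLinearMap.pi fun i => innerSL ℝ (c i))

theorem coordCLM_apply {D : ℕ} (c : Fin D → E) (y : E) (i : Fin D) :
    coordCLM c y i = inner ℝ y (c i) := by
  rw [real_inner_comm]; rfl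

theorem norm_coordCLM_le {D : ℕ} (c : Fin D → E) (y : E) :
    ‖coordCLM c y‖ ≤ ∑ i, |inner ℝ y (c i)| := by
  rw [EuclideanSpace.norm_eq]
  refine Real.sqrt_le_iff.2 ⟨Finset.sum_nonneg fun _ _ => abs_nonneg _, ?_⟩
  simp only [coordCLM_apply, Real.norm_eq_abs]
  exact Finset.sum_sq_le_sq_sum_of_nonneg fun _ _ => abs_nonneg _

theorem form_le_of_basis {D : ℕ} {c b : Fin D → E}
    (hc : ∀ y, y = ∑ i, (inner ℝ y (c i) : ℝ) • b i) {T : E →L[ℝ] E} (hT : T.IsPositive) (y : E) :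
    form T y ≤ 2 ^ D * ‖coordCLM c y‖ ^ 2 * ∑ i, form T (b i) := by
  conv_lhs => rw [hc y]
  refine (form_sum_le hT _ _).trans ?_
  rw [Finset.card_univ, Fintype.card_fin]
  conv_rhs => rw [mul_assoc, Finset.mul_sum]
  refine mul_le_mul_of_nonneg_left (Finset.sum_le_sum fun i _ => ?_) (by positivity)
  rw [form_smul, EuclideanSpace.norm_sq_eq]
  refine mul_le_mul_of_nonneg_right ?_ (form_nonneg hT _)
  have := Finset.single_le_sum (f := fun i => ‖coordCLM c y i‖ ^ 2) (fun _ _ => sq_nonneg _)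
    (Finset.mem_univ i)
  simpa [coordCLM_apply] using this

theorem aemeasurable_form {S : Set X} (hW : IntegrableOn W S σ) {y : X → E}
    (hy : AEStronglyMeasurable y (σ.restrict S)) :
    AEMeasurable (fun x => ENNReal.ofReal (form (W x) (y x))) (σ.restrict S) :=
  (continuous_form.comp_aestronglyMeasurable
    (hW.aestronglyMeasurable.prodMk hy)).aemeasurable.ennreal_ofReal

variable [FiniteDimensional ℝ E]

theorem avg_comp_clm {F : Type*} [NormedAddCommGroup F] [NormedSpace ℝ F] [CompleteSpace F]
    (hV : LocInt 𝒟 V) (L : E →L[ℝ] F) (e : E) (n : ℤ) (x : X) :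
    𝒟.avg n (fun y => L (V y e)) x = L (𝒟.avg n V x e) := by
  have hI : IntegrableOn V (𝒟.cell n x) σ := hV ⟨n, _, 𝒟.cell_mem n x⟩
  have h1 : Integrable (fun y => V y e) (σ.restrict (𝒟.cell n x)) :=
    hI.apply_continuousLinearMap e
  simp only [avg, setAverage_eq]
  rw [L.integral_comp_comm h1, ← ContinuousLinearMap.integral_apply hI]
  simp

/-- The matrix weighted square function of `V e` is controlled by the maximal function of the scalar
weight `⟪V e, e⟫`. On each atom `J` a stopping time keeps the martingale and the square function of
`V e` bounded by a multiple of their natural size, measured in a basis adapted to `⟨V⟩_J`, and stops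
on at most half of `J`; where it has stopped, the argument starts again. -/
theorem IsWeightPair.testing (h : IsWeightPair 𝒟 V W A) (e : E) (m : ℕ) :
    ∀ J : Atom 𝒟, ∫⁻ x in J.set, testSum 𝒟 V W e J.rk m x ∂σ ≤
      ENNReal.ofReal (testConst (Module.finrank ℝ E) * A) *
        ∫⁻ x in J.set, localMax J (fun y => form (V y) e) x ∂σ := by
  induction m using Nat.strong_induction_on with
  | _ m ih =>
  rintro ⟨a, J, hJ⟩
  simp only
  set K := ENNReal.ofReal (testConst (Module.finrank ℝ E) * A) with hK
  set D := Module.finrank ℝ E with hD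
  set M := localMax (⟨a, J, hJ⟩ : Atom 𝒟) (fun y => form (V y) e) with hM
  rcases J.eq_empty_or_nonempty with rfl | ⟨x₀, hx₀⟩
  · simp
  by_cases hJ0 : σ J = 0
  · simp [Measure.restrict_eq_zero.2 hJ0]
  by_cases he : e = 0
  · simp [testSum, he]
  have hA := h.nonneg
  have hVJ := h.locInt_left ⟨a, J, hJ⟩
  have hWJ := h.locInt_right ⟨a, J, hJ⟩
  have hσJ := measure_ne_top hJ
  have hJpos : 0 < σ.real J := ENNReal.toReal_pos hJ0 hσJ
  have hs : 0 ≤ σ.real J := hJpos.le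
  set VJ := ⨍ x in J, V x ∂σ with hVJdef
  have hpd : IsPosDef VJ := isPosDef_setAverage hVJ h.posDef hJ0 hσJ
  obtain ⟨c, hc1, hc2⟩ := hpd.exists_orthonormal hD.symm
  set v := form VJ e with hv
  have hv0 : 0 < v := hpd.form_pos e he
  -- six times a bound for the average norm of the normalized function; `D + 1` in place of `D`
  -- keeps it positive
  set r := 6 * (D + 1) * √v with hr
  have hr0 : 0 < r := by have := Real.sqrt_pos.2 hv0; positivity
  have hr2 : r ^ 2 = 36 * (D + 1) ^ 2 * v := by rw [hr, mul_pow, Real.sq_sqrt hv0.le]; ring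
  set f : X → EuclideanSpace ℝ (Fin D) := fun x => coordCLM c (V x e) with hf
  have hfJ : IntegrableOn f J σ :=
    (coordCLM c).integrable_comp (hVJ.apply_continuousLinearMap e)
  -- the average of the normalized function is at most `D √v`
  have hfr : 6 * ∫ x in J, ‖f x‖ ∂σ ≤ r * σ.real J := by
    have hci : ∀ i, IntegrableOn (fun x => |inner ℝ (V x e) (c i)|) J σ := fun i =>
      ((hVJ.apply_continuousLinearMap e).inner_const (c i)).abs
    have h1 : ∀ i, ∫ x in J, |inner ℝ (V x e) (c i)| ∂σ ≤ √v * σ.real J := by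
      intro i
      have hform1 : form VJ (c i) = 1 := by simp [form, hc1]
      have i1 := integrableOn_form hVJ e
      have i2 := (integrableOn_form hVJ (c i)).const_mul v
      have h2 : ∫ x in J, 2 * √v * |inner ℝ (V x e) (c i)| ∂σ ≤
          ∫ x in J, (form (V x) e + v * form (V x) (c i)) ∂σ := by
        refine integral_mono_ae ((hci i).const_mul _) (i1.add i2) ?_
        filter_upwards [ae_restrict_of_ae h.posDef] with x hx
        have h3 := abs_inner_le_of_isPositive hx.isPositive e (√v • c i)
        rw [inner_smul_right, abs_mul, abs_of_nonneg (Real.sqrt_nonneg v), form_smul,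
          Real.sq_sqrt hv0.le] at h3
        linarith
      rw [integral_const_mul, integral_add i1 i2, integral_const_mul, setIntegral_form_eq hJ hVJ,
        setIntegral_form_eq hJ hVJ, ← hVJdef, hform1, ← hv] at h2
      have h4 : √v * ∫ x in J, |inner ℝ (V x e) (c i)| ∂σ ≤ √v * (√v * σ.real J) := by
        have := Real.mul_self_sqrt hv0.le
        rw [← mul_assoc, this]
        linarith
      exact le_of_mul_le_mul_left h4 (Real.sqrt_pos.2 hv0)
    have h5 : ∫ x in J, ‖f x‖ ∂σ ≤ D * (√v * σ.real J) := by
      calc ∫ x in J, ‖f x‖ ∂σ ≤ ∫ x in J, ∑ i, |inner ℝ (V x e) (c i)| ∂σ :=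
            integral_mono_ae hfJ.norm (integrable_finsetSum _ fun i _ => hci i)
              (.of_forall fun x => norm_coordCLM_le c _)
        _ = ∑ i, ∫ x in J, |inner ℝ (V x e) (c i)| ∂σ := integral_finsetSum _ fun i _ => hci i
        _ ≤ ∑ _i : Fin D, √v * σ.real J := Finset.sum_le_sum fun i _ => h1 i
        _ = D * (√v * σ.real J) := by simp
    have h6 : 0 ≤ √v * σ.real J := by positivity
    rw [hr]
    nlinarith
  set S := aliveSet 𝒟 a f r J with hSdef
  have hmS : ∀ n, MeasurableSet (S n) := fun n => measurableSet_aliveSet' hJ n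
  have hSJ : ∀ n, S n ⊆ J := fun n => aliveSet_subset n
  have hS0 : S 0 = J := by
    refine Set.Subset.antisymm (hSJ 0) fun x hx => ⟨hx, fun j hj => ?_⟩
    obtain rfl : j = 0 := by lia
    simp only [Nat.cast_zero, add_zero, sqSum, Finset.range_zero, Finset.sum_empty]
    refine ⟨?_, by positivity⟩
    rw [avg_eq hJ hx, setAverage_eq, norm_smul, norm_inv, Real.norm_of_nonneg hs,
      inv_mul_le_iff₀ hJpos]
    have := norm_integral_le_integral_norm (μ := σ.restrict J) f
    have h7 : 0 ≤ ∫ x in J, ‖f x‖ ∂σ := integral_nonneg fun _ => norm_nonneg _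
    linarith
  have hhalf : σ.real J ≤ 2 * σ.real (S m) := measureReal_le_two_mul_aliveSet hJ hfJ hr0 hfr m
  have hpart := setLIntegral_eq_add_sum_sdiff (σ := σ) hmS (fun n => aliveSet_succ_subset n)
  have hle (φ : X → ℝ≥0∞) : ∑ j ∈ Finset.range m, ∫⁻ x in S j \ S (j + 1), φ x ∂σ ≤
      ∫⁻ x in J, φ x ∂σ := by
    rw [← hS0, hpart φ m]
    exact le_add_self
  -- the weight measured in the dual basis
  set w : X → ℝ := fun x => ∑ i, form (W x) (VJ (c i)) with hw
  have hw0 : ∀ᵐ x ∂σ, 0 ≤ w x := h.isPositive.mono fun x hx =>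
    Finset.sum_nonneg fun i _ => form_nonneg hx _
  have hwJ : ∫⁻ x in J, ENNReal.ofReal (w x) ∂σ ≤ ENNReal.ofReal (D * A * σ.real J) := by
    have hint : IntegrableOn w J σ := integrable_finsetSum _ fun i _ => integrableOn_form hWJ _
    rw [← ofReal_integral_eq_lintegral_ofReal hint (ae_restrict_of_ae hw0)]
    refine ENNReal.ofReal_le_ofReal ?_
    rw [hw, integral_finsetSum _ fun i _ => integrableOn_form hWJ _]
    calc _ ≤ ∑ _i : Fin D, σ.real J * A := by
          refine Finset.sum_le_sum fun i _ => ?_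
          rw [setIntegral_form_eq hJ hWJ]
          refine mul_le_mul_of_nonneg_left ((h.a2 ⟨a, J, hJ⟩ (c i)).trans_eq ?_) hs
          simp only [← hVJdef]
          simp [form, hc1]
      _ = D * A * σ.real J := by simp; ring
  have hdiff (n : ℤ) (x : X) : 𝒟.avg n f x = coordCLM c (𝒟.avg n V x e) :=
    avg_comp_clm h.locInt_left (coordCLM c) e n x
  have hptw {x : X} (hx : (W x).IsPositive) {y : E} {q : ℝ} (hq : ‖coordCLM c y‖ ^ 2 ≤ q) :
      form (W x) y ≤ 2 ^ D * q * w x := by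
    refine (form_le_of_basis hc2 hx y).trans ?_
    have : 0 ≤ w x := Finset.sum_nonneg fun i _ => form_nonneg hx _
    exact mul_le_mul_of_nonneg_right (mul_le_mul_of_nonneg_left hq (by positivity)) this
  -- as long as the martingale is alive, the sum is controlled by the weight `w`
  have halive : ∀ n, ∀ᵐ x ∂σ, x ∈ S n → testSum 𝒟 V W e a n x ≤
      ENNReal.ofReal (2 ^ D * (5 * r ^ 2) * w x) := by
    intro n
    filter_upwards [h.isPositive] with x hx hxS
    have hwx : 0 ≤ w x := Finset.sum_nonneg fun i _ => form_nonneg hx _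
    unfold testSum
    rw [← ENNReal.ofReal_sum_of_nonneg fun i _ => form_nonneg hx _]
    refine ENNReal.ofReal_le_ofReal ?_
    calc _ ≤ ∑ j ∈ Finset.range n,
          2 ^ D * ‖𝒟.avg (a + (j + 1 : ℕ)) f x - 𝒟.avg (a + j) f x‖ ^ 2 * w x := by
          refine Finset.sum_le_sum fun j _ => hptw hx ?_
          rw [hdiff, hdiff, ← map_sub]
          simp
      _ = 2 ^ D * sqSum 𝒟 a f n x * w x := by
          rw [← Finset.sum_mul, ← Finset.mul_sum, sqSum]
      _ ≤ _ := by
          gcongr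
          exact (hxS.2 n le_rfl).2
  have hwm : AEMeasurable (fun x => ENNReal.ofReal (w x)) (σ.restrict J) :=
    (integrable_finsetSum _ fun i _ => integrableOn_form hWJ _ :
      IntegrableOn w J σ).aestronglyMeasurable.aemeasurable.ennreal_ofReal
  have hcw (q : ℝ) (hq : 0 ≤ q) (B : Set X) (_ : B ⊆ J) :
      ∫⁻ x in B, ENNReal.ofReal (q * w x) ∂σ =
      ENNReal.ofReal q * ∫⁻ x in B, ENNReal.ofReal (w x) ∂σ := by
    rw [← lintegral_const_mul' _ _ ENNReal.ofReal_ne_top]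
    simp_rw [ENNReal.ofReal_mul hq]
  -- the sum on the set where the martingale stops at time `j + 1`
  have hZ : ∀ j < m, ∫⁻ x in S j \ S (j + 1), testSum 𝒟 V W e a m x ∂σ ≤
      ENNReal.ofReal (2 ^ D * (7 * r ^ 2)) * ∫⁻ x in S j \ S (j + 1), ENNReal.ofReal (w x) ∂σ +
      ENNReal.ofReal (2 * A) * ∫⁻ x in S j \ S (j + 1), ENNReal.ofReal (form (V x) e) ∂σ +
      K * ∫⁻ x in S j \ S (j + 1), M x ∂σ := by
    intro j hj
    have hZJ : S j \ S (j + 1) ⊆ J := Set.sdiff_subset.trans (hSJ j)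
    have hmZ : MeasurableSet (S j \ S (j + 1)) := (hmS j).diff (hmS (j + 1))
    have hmZ1 : MeasurableSet[𝒟.ℱ (a + (j + 1 : ℕ))] (S j \ S (j + 1)) :=
      (𝒟.ℱ.mono (by lia) _ (measurableSet_aliveSet hJ j)).diff (measurableSet_aliveSet hJ (j + 1))
    set Z := S j \ S (j + 1) with hZdef
    obtain ⟨q, rfl⟩ : ∃ q, m = j + 1 + q := ⟨m - (j + 1), by lia⟩
    have htail : ∫⁻ x in Z, testSum 𝒟 V W e (a + (j + 1 : ℕ)) q x ∂σ ≤ K * ∫⁻ x in Z, M x ∂σ := by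
      rw [← lintegral_const_mul' _ _ ENNReal.ofReal_ne_top]
      refine setLIntegral_mono_of_atoms hmZ1 fun I hI hIZ => ?_
      rw [lintegral_const_mul' _ _ ENNReal.ofReal_ne_top]
      refine (ih q (by lia) ⟨_, I, hI⟩).trans ?_
      refine mul_le_mul_right (lintegral_mono fun x => localMax_mono ?_ _ x) _
      exact ⟨hIZ.trans hZJ, by simp only; lia⟩
    have hpt : ∀ᵐ x ∂σ.restrict Z, testSum 𝒟 V W e a (j + 1 + q) x ≤
        ENNReal.ofReal (2 ^ D * (7 * r ^ 2) * w x) +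
        2 * ENNReal.ofReal (form (W x) (𝒟.avg (a + (j + 1 : ℕ)) V x e)) +
        testSum 𝒟 V W e (a + (j + 1 : ℕ)) q x := by
      filter_upwards [ae_restrict_of_ae (halive j), ae_restrict_of_ae h.isPositive,
        ae_restrict_mem hmZ] with x hx hWx hxZ
      have hwx : 0 ≤ w x := Finset.sum_nonneg fun i _ => form_nonneg hWx _
      rw [testSum_add]
      gcongr
      rw [testSum_add, testSum, testSum, Finset.sum_range_one]
      have h1 : form (W x) (𝒟.avg (a + j) V x e) ≤ 2 ^ D * r ^ 2 * w x := by
        refine hptw hWx ?_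
        rw [← hdiff]
        gcongr
        exact norm_avg_le_of_mem_aliveSet hxZ.1
      have h2 := form_sub_le hWx (𝒟.avg (a + (j + 1 : ℕ)) V x e) (𝒟.avg (a + j) V x e)
      have h3 := form_nonneg hWx (𝒟.avg (a + (j + 1 : ℕ)) V x e)
      calc _ ≤ ENNReal.ofReal (2 ^ D * (5 * r ^ 2) * w x) + ENNReal.ofReal
            (2 * form (W x) (𝒟.avg (a + (j + 1 : ℕ)) V x e) + 2 * (2 ^ D * r ^ 2 * w x)) := by
            gcongr
            · exact hx hxZ.1
            · have h4 : a + (j : ℤ) + ((0 + 1 : ℕ) : ℤ) = a + ((j + 1 : ℕ) : ℤ) := by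
                push_cast; ring
              rw [h4, Nat.cast_zero, add_zero]
              simp only [sub_apply]
              linarith
        _ = _ := by
            rw [← ENNReal.ofReal_add (by positivity) (by positivity), ← ENNReal.ofReal_ofNat 2,
              ← ENNReal.ofReal_mul (by norm_num), ← ENNReal.ofReal_add (by positivity)
              (by positivity)]
            congr 1
            ring
    have hy : AEStronglyMeasurable (fun x => 𝒟.avg (a + (j + 1 : ℕ)) V x e) (σ.restrict J) :=
      ((ContinuousLinearMap.apply ℝ E e).continuous.comp_stronglyMeasurable
        (stronglyMeasurable_avg (a + (j + 1 : ℕ)) V)).aestronglyMeasurable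
    have hm2 := (aemeasurable_form hWJ hy).mono_measure (Measure.restrict_mono_set σ hZJ)
    have hm1 := (hwm.const_mul (ENNReal.ofReal (2 ^ D * (7 * r ^ 2)))).mono_measure
      (Measure.restrict_mono_set σ hZJ)
    simp_rw [← ENNReal.ofReal_mul (show (0:ℝ) ≤ 2 ^ D * (7 * r ^ 2) by positivity)] at hm1
    have ha2 : ∫⁻ x in Z, ENNReal.ofReal (form (W x) (𝒟.avg (a + (j + 1 : ℕ)) V x e)) ∂σ ≤
        ENNReal.ofReal A * ∫⁻ x in Z, ENNReal.ofReal (form (V x) e) ∂σ := by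
      rw [← h.setLIntegral_avg_form hmZ1]
      exact h.setLIntegral_le hmZ1 (y := fun _ => e) fun _ _ _ _ _ _ => rfl
    calc _ ≤ _ := lintegral_mono_ae hpt
      _ = ENNReal.ofReal (2 ^ D * (7 * r ^ 2)) * ∫⁻ x in Z, ENNReal.ofReal (w x) ∂σ +
          2 * ∫⁻ x in Z, ENNReal.ofReal (form (W x) (𝒟.avg (a + (j + 1 : ℕ)) V x e)) ∂σ +
          ∫⁻ x in Z, testSum 𝒟 V W e (a + (j + 1 : ℕ)) q x ∂σ := by
        have hm3 : AEMeasurable (fun x => ENNReal.ofReal (2 ^ D * (7 * r ^ 2) * w x) +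
            2 * ENNReal.ofReal (form (W x) (𝒟.avg (a + (j + 1 : ℕ)) V x e))) (σ.restrict Z) :=
          hm1.add (hm2.const_mul 2)
        rw [lintegral_add_left' hm3, lintegral_add_left' hm1,
          hcw _ (by positivity) Z hZJ, lintegral_const_mul' _ _ (by norm_num)]
      _ ≤ _ := by
        rw [ENNReal.ofReal_mul (by norm_num : (0:ℝ) ≤ 2), ENNReal.ofReal_ofNat, mul_assoc]
        gcongr
  -- on the set where the martingale never stops, the maximal function is at least the average
  have hMS : ENNReal.ofReal (v * σ.real (S m)) ≤ ∫⁻ x in S m, M x ∂σ := by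
    have hav : ⨍ y in J, form (V y) e ∂σ = v := by
      rw [setAverage_eq, setIntegral_form_eq hJ hVJ, smul_eq_mul, ← hVJdef, ← hv,
        inv_mul_cancel_left₀ hJpos.ne']
    calc ENNReal.ofReal (v * σ.real (S m)) = ∫⁻ _ in S m, ENNReal.ofReal v ∂σ := by
          rw [setLIntegral_const, ENNReal.ofReal_mul hv0.le,
            ofReal_measureReal (measure_ne_top_of_subset (hSJ m) hσJ)]
      _ ≤ _ := by
          refine setLIntegral_mono' (hmS m) fun x hx => ?_
          have := enorm_average_le_localMax (⟨a, J, hJ⟩ : Atom 𝒟) (fun y => form (V y) e)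
            (hSJ m hx)
          simp only [hav] at this
          rwa [Real.enorm_of_nonneg hv0.le] at this
  have hVJv : ∫⁻ x in J, ENNReal.ofReal (form (V x) e) ∂σ = ENNReal.ofReal (σ.real J * v) :=
    setLIntegral_form_eq hJ hVJ (h.posDef.mono fun _ h => h.isPositive) e
  have hconst : 2 ^ D * (7 * r ^ 2) * (D * A * σ.real J) + 2 * A * (σ.real J * v) ≤
      testConst D * A * (v * σ.real (S m)) := by
    rw [hr2, testConst]
    have h8 : 0 ≤ (7 * 2 ^ D * (36 * (D + 1) ^ 2) * D + 2) * A * v := by positivity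
    nlinarith [mul_le_mul_of_nonneg_left hhalf h8]
  calc ∫⁻ x in J, testSum 𝒟 V W e a m x ∂σ
      = ∫⁻ x in S m, testSum 𝒟 V W e a m x ∂σ +
        ∑ j ∈ Finset.range m, ∫⁻ x in S j \ S (j + 1), testSum 𝒟 V W e a m x ∂σ := by
        rw [← hS0, hpart _ m]
    _ ≤ ENNReal.ofReal (2 ^ D * (7 * r ^ 2)) * ∫⁻ x in S m, ENNReal.ofReal (w x) ∂σ +
        ∑ j ∈ Finset.range m,
        (ENNReal.ofReal (2 ^ D * (7 * r ^ 2)) * ∫⁻ x in S j \ S (j + 1), ENNReal.ofReal (w x) ∂σ +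
        ENNReal.ofReal (2 * A) * ∫⁻ x in S j \ S (j + 1), ENNReal.ofReal (form (V x) e) ∂σ +
        K * ∫⁻ x in S j \ S (j + 1), M x ∂σ) := by
        refine add_le_add ?_ (Finset.sum_le_sum fun j hj => hZ j (Finset.mem_range.1 hj))
        rw [← hcw _ (by positivity) _ (hSJ m)]
        refine lintegral_mono_ae ?_
        filter_upwards [ae_restrict_of_ae (halive m), ae_restrict_of_ae hw0,
          ae_restrict_mem (hmS m)] with x hx hwx hxS
        refine (hx hxS).trans (ENNReal.ofReal_le_ofReal ?_)
        gcongr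
        norm_num
    _ = ENNReal.ofReal (2 ^ D * (7 * r ^ 2)) * ∫⁻ x in J, ENNReal.ofReal (w x) ∂σ +
        ENNReal.ofReal (2 * A) *
          ∑ j ∈ Finset.range m, ∫⁻ x in S j \ S (j + 1), ENNReal.ofReal (form (V x) e) ∂σ +
        K * ∑ j ∈ Finset.range m, ∫⁻ x in S j \ S (j + 1), M x ∂σ := by
        conv_rhs => rw [← hS0, hpart (fun x => ENNReal.ofReal (w x)) m]
        rw [Finset.sum_add_distrib, Finset.sum_add_distrib, ← Finset.mul_sum, ← Finset.mul_sum,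
          ← Finset.mul_sum]
        ring
    _ ≤ ENNReal.ofReal (2 ^ D * (7 * r ^ 2)) * ENNReal.ofReal (D * A * σ.real J) +
        ENNReal.ofReal (2 * A) * ENNReal.ofReal (σ.real J * v) +
        K * ∑ j ∈ Finset.range m, ∫⁻ x in S j \ S (j + 1), M x ∂σ := by
        gcongr
        exact (hle _).trans_eq hVJv
    _ ≤ K * ∫⁻ x in S m, M x ∂σ + K * ∑ j ∈ Finset.range m, ∫⁻ x in S j \ S (j + 1), M x ∂σ := by
        gcongr
        refine le_trans ?_ (mul_le_mul_right hMS K)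
        rw [hK, ← ENNReal.ofReal_mul (by positivity), ← ENNReal.ofReal_mul (by positivity),
          ← ENNReal.ofReal_mul (mul_nonneg (testConst_nonneg D) hA),
          ← ENNReal.ofReal_add (by positivity) (by positivity)]
        exact ENNReal.ofReal_le_ofReal hconst
    _ = K * ∫⁻ x in J, M x ∂σ := by
        conv_rhs => rw [← hS0, hpart M m]
        rw [mul_add]

end

/-! ### The Carleson embedding theorem with operator weights -/

section

open AtomicFiltration

variable {X : Type v} [MeasurableSpace X] {σ : Measure X} {𝒟 : AtomicFiltration σ}

section LocInt

variable {F : Type*} [NormedAddCommGroup F] {f g : X → F}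

theorem locInt_add (hf : LocInt 𝒟 f) (hg : LocInt 𝒟 g) : LocInt 𝒟 fun x => f x + g x :=
  fun I => (hf I).add (hg I)

theorem locInt_sum {ι : Type*} (s : Finset ι) {f : ι → X → F} (hf : ∀ i, LocInt 𝒟 (f i)) :
    LocInt 𝒟 fun x => ∑ i ∈ s, f i x :=
  fun I => integrable_finsetSum _ fun i _ => hf i I

variable [NormedSpace ℝ F]

theorem locInt_smul (hf : LocInt 𝒟 f) (t : ℝ) : LocInt 𝒟 fun x => t • f x :=
  fun I => (hf I).smul t

theorem avg_add (hf : LocInt 𝒟 f) (hg : LocInt 𝒟 g) (n : ℤ) (x : X) :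
    𝒟.avg n (fun y => f y + g y) x = 𝒟.avg n f x + 𝒟.avg n g x := by
  have h1 := hf ⟨n, _, 𝒟.cell_mem n x⟩
  have h2 := hg ⟨n, _, 𝒟.cell_mem n x⟩
  simp only [avg, setAverage_eq]
  rw [integral_add h1 h2, smul_add]

theorem avg_smul (f : X → F) (t : ℝ) (n : ℤ) (x : X) :
    𝒟.avg n (fun y => t • f y) x = t • 𝒟.avg n f x := by
  simp only [avg, setAverage_eq]
  rw [integral_smul, smul_comm]

end LocInt

variable {E : Type*} [NormedAddCommGroup E] [InnerProductSpace ℝ E]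

theorem isPositive_sum {ι : Type*} (s : Finset ι) {T : ι → E →L[ℝ] E}
    (hT : ∀ i ∈ s, (T i).IsPositive) : (∑ i ∈ s, T i).IsPositive := by
  classical
  induction s using Finset.induction_on with
  | empty => simp
  | insert i s hi ih =>
    rw [Finset.sum_insert hi]
    exact (hT i (Finset.mem_insert_self i s)).add
      (ih fun j hj => hT j (Finset.mem_insert_of_mem hj))

theorem form_sum_left {ι : Type*} (s : Finset ι) (T : ι → E →L[ℝ] E) (e : E) :
    form (∑ i ∈ s, T i) e = ∑ i ∈ s, form (T i) e := by
  simp only [← formCLM_apply, map_sum]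

/-- The positive operator whose form is that of `W` on the martingale difference of `V`. -/
def diffOp (𝒟 : AtomicFiltration σ) (V W : X → E →L[ℝ] E) (n : ℤ) (x : X) : E →L[ℝ] E :=
  (𝒟.avg (n + 1) V x - 𝒟.avg n V x) ∘L W x ∘L (𝒟.avg (n + 1) V x - 𝒟.avg n V x)

variable {V W : X → E →L[ℝ] E} {A K : ℝ}

theorem isPositive_diffOp {n : ℤ} {x : X} (hV : ∀ n, (𝒟.avg n V x).IsPositive)
    (hW : (W x).IsPositive) : (diffOp 𝒟 V W n x).IsPositive ∧ ∀ e, form (diffOp 𝒟 V W n x) e =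
      form (W x) ((𝒟.avg (n + 1) V x - 𝒟.avg n V x) e) := by
  have hsym (u w : E) : inner ℝ ((𝒟.avg (n + 1) V x - 𝒟.avg n V x) u) w =
      inner ℝ u ((𝒟.avg (n + 1) V x - 𝒟.avg n V x) w) := by
    simp only [sub_apply, inner_sub_left, inner_sub_right]
    rw [inner_symm_of_isPositive (hV _), inner_symm_of_isPositive (hV _)]
  have hform (e : E) : form (diffOp 𝒟 V W n x) e =
      form (W x) ((𝒟.avg (n + 1) V x - 𝒟.avg n V x) e) := by
    rw [form, diffOp, form, ContinuousLinearMap.comp_apply, ContinuousLinearMap.comp_apply, hsym]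
  refine ⟨⟨fun u w => ?_, fun u => ?_⟩, hform⟩
  · simp only [diffOp, ContinuousLinearMap.coe_coe, ContinuousLinearMap.comp_apply]
    rw [hsym, inner_symm_of_isPositive hW, hsym]
  · exact (form_nonneg hW _).trans_eq (hform u).symm

theorem opNorm_le_sum_form {D : ℕ} (b : OrthonormalBasis (Fin D) ℝ E) {T : E →L[ℝ] E}
    (hT : T.IsPositive) : ‖T‖ ≤ D * ∑ i, form T (b i) := by
  have h0 : 0 ≤ ∑ i, form T (b i) := Finset.sum_nonneg fun i _ => form_nonneg hT _
  refine T.opNorm_le_bound (by positivity) fun x => ?_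
  have h1 (y : E) : ‖y‖ ≤ ∑ j, |inner ℝ (b j) y| := by
    conv_lhs => rw [← b.sum_repr' y]
    refine (norm_sum_le _ _).trans (Finset.sum_le_sum fun j _ => ?_)
    rw [norm_smul, b.orthonormal.1 j, mul_one, Real.norm_eq_abs]
  have h2 (i j : Fin D) : |inner ℝ (b j) (T (b i))| ≤ (form T (b i) + form T (b j)) / 2 := by
    have := abs_inner_le_of_isPositive hT (b i) (b j)
    rw [real_inner_comm]
    linarith
  have h3 (j : Fin D) : |inner ℝ (b j) (T x)| ≤
      ∑ i, ‖x‖ * ((form T (b i) + form T (b j)) / 2) := by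
    conv_lhs => rw [← b.sum_repr' x]
    rw [map_sum, inner_sum]
    refine (Finset.abs_sum_le_sum_abs _ _).trans (Finset.sum_le_sum fun i _ => ?_)
    rw [map_smul, inner_smul_right, abs_mul]
    refine mul_le_mul ?_ (h2 i j) (abs_nonneg _) (norm_nonneg _)
    simpa [b.orthonormal.1 i] using abs_real_inner_le_norm (b i) x
  calc ‖T x‖ ≤ _ := h1 _
    _ ≤ ∑ j, ∑ i, ‖x‖ * ((form T (b i) + form T (b j)) / 2) := Finset.sum_le_sum fun j _ => h3 j
    _ = D * (∑ i, form T (b i)) * ‖x‖ := by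
      simp_rw [← Finset.mul_sum, ← Finset.sum_div, Finset.sum_add_distrib]
      simp only [Finset.sum_const, Finset.card_univ, Fintype.card_fin, nsmul_eq_mul]
      rw [← Finset.mul_sum]
      ring

variable [FiniteDimensional ℝ E]

theorem integrableOn_of_form {T : X → E →L[ℝ] E} {I : Set X}
    (hm : AEStronglyMeasurable T (σ.restrict I)) (hpos : ∀ᵐ x ∂σ, (T x).IsPositive)
    (hfin : ∀ e, ∫⁻ x in I, ENNReal.ofReal (form (T x) e) ∂σ ≠ ∞) : IntegrableOn T I σ := by
  let b := stdOrthonormalBasis ℝ E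
  have hint : ∀ e, IntegrableOn (fun x => form (T x) e) I σ := fun e =>
    (lintegral_ofReal_ne_top_iff_integrable
      (continuous_form.comp_aestronglyMeasurable (hm.prodMk aestronglyMeasurable_const))
      (ae_restrict_of_ae (hpos.mono fun x hx => form_nonneg hx e))).1 (hfin e)
  have hsum : IntegrableOn (fun x => ∑ i, form (T x) (b i)) I σ :=
    integrable_finsetSum _ fun i _ => hint (b i)
  refine Integrable.mono' (hsum.const_mul (Module.finrank ℝ E : ℝ)) hm ?_
  filter_upwards [ae_restrict_of_ae hpos] with x hx using opNorm_le_sum_form b hx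

theorem IsWeightPair.isPositive_diffOp (h : IsWeightPair 𝒟 V W A) :
    ∀ᵐ x ∂σ, ∀ n, (diffOp 𝒟 V W n x).IsPositive ∧ ∀ e, form (diffOp 𝒟 V W n x) e =
      form (W x) ((𝒟.avg (n + 1) V x - 𝒟.avg n V x) e) := by
  filter_upwards [h.posDef_avg, h.isPositive] with x hV hW n
  exact AtomicSq.isPositive_diffOp (fun n => (hV n).isPositive) hW

/-- The testing condition with constant `K`: on every atom the weighted square function of `V e` is
controlled by the mass of the scalar weight `⟪V e, e⟫`. -/
def TestingCondition (𝒟 : AtomicFiltration σ) (V W : X → E →L[ℝ] E) (K : ℝ) : Prop :=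
  ∀ (e : E) (m : ℕ) (J : Atom 𝒟), ∫⁻ x in J.set, testSum 𝒟 V W e J.rk m x ∂σ ≤
    ENNReal.ofReal K * ∫⁻ x in J.set, ENNReal.ofReal (form (V x) e) ∂σ

theorem IsWeightPair.locInt_diffOp (h : IsWeightPair 𝒟 V W A) (ht : TestingCondition 𝒟 V W K)
    (n : ℤ) : LocInt 𝒟 (diffOp 𝒟 V W n) := by
  rintro ⟨k, I, hI⟩
  rcases I.eq_empty_or_nonempty with rfl | ⟨x₀, hx₀⟩
  · simp
  -- the atom is contained in one of generation at most `n`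
  set k₀ := min k n with hk₀
  set J := 𝒟.cell k₀ x₀ with hJdef
  have hJ : J ∈ 𝒟.D k₀ := 𝒟.cell_mem k₀ x₀
  have hIJ : I ⊆ J := by
    rw [← cell_eq hI hx₀]
    exact cell_subset (measurableSet_of_mem_le (by lia) hJ) (𝒟.mem_cell k₀ x₀)
  suffices IntegrableOn (diffOp 𝒟 V W n) J σ from this.mono_set hIJ
  have hVJ := h.locInt_left ⟨k₀, J, hJ⟩
  have hWJ := h.locInt_right ⟨k₀, J, hJ⟩
  refine integrableOn_of_form ?_ (h.isPositive_diffOp.mono fun x hx => (hx n).1) fun e => ?_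
  · have hd : AEStronglyMeasurable (fun x => 𝒟.avg (n + 1) V x - 𝒟.avg n V x) (σ.restrict J) :=
      ((stronglyMeasurable_avg (n + 1) V).sub (stronglyMeasurable_avg n V)).aestronglyMeasurable
    have hc : Continuous fun p : (E →L[ℝ] E) × (E →L[ℝ] E) => p.1 ∘L p.2 ∘L p.1 := by fun_prop
    exact hc.comp_aestronglyMeasurable (hd.prodMk hWJ.aestronglyMeasurable)
  · obtain ⟨j, hj⟩ : ∃ j : ℕ, n = k₀ + j := ⟨(n - k₀).toNat, by lia⟩
    have h1 : ∫⁻ x in J, ENNReal.ofReal (form (diffOp 𝒟 V W n x) e) ∂σ ≤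
        ∫⁻ x in J, testSum 𝒟 V W e k₀ (j + 1) x ∂σ := by
      refine lintegral_mono_ae ?_
      filter_upwards [ae_restrict_of_ae h.isPositive_diffOp] with x hx
      rw [(hx n).2, testSum, Finset.sum_range_succ, hj, Nat.cast_add, Nat.cast_one, ← add_assoc]
      exact le_add_self
    refine ne_top_of_le_ne_top ?_ (h1.trans (ht e (j + 1) ⟨k₀, J, hJ⟩))
    rw [setLIntegral_form_eq hJ hVJ (h.posDef.mono fun _ h => h.isPositive)]
    exact ENNReal.mul_ne_top ENNReal.ofReal_ne_top ENNReal.ofReal_ne_top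

/-- The operator weight `V` increased by `t` times the contributions of the generations
`a + k, …, a + N - 1` to the Carleson sum. -/
def raised (𝒟 : AtomicFiltration σ) (V W : X → E →L[ℝ] E) (a : ℤ) (N : ℕ) (t : ℝ) (k : ℕ) (x : X) :
    E →L[ℝ] E :=
  V x + t • ∑ j ∈ Finset.Ico k N, diffOp 𝒟 V W (a + j) x

/-- By the testing condition, the average of the remaining part of the Carleson sum is dominated by
the average of `V`. -/
theorem IsWeightPair.form_avg_sum_le (h : IsWeightPair 𝒟 V W A) (hK : 0 < K)
    (ht : TestingCondition 𝒟 V W K) {a : ℤ} {N k : ℕ} {x : X}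
    (hx : σ (𝒟.cell (a + k) x) ≠ 0) (e : E) :
    form (K⁻¹ • 𝒟.avg (a + k) (fun y => ∑ j ∈ Finset.Ico k N, diffOp 𝒟 V W (a + j) y) x) e ≤
      form (𝒟.avg (a + k) V x) e := by
  set I := 𝒟.cell (a + k) x with hIdef
  have hI : I ∈ 𝒟.D (a + k) := 𝒟.cell_mem _ x
  have hσI := measure_ne_top hI
  have hTI : IntegrableOn (fun y => ∑ j ∈ Finset.Ico k N, diffOp 𝒟 V W (a + j) y) I σ :=
    locInt_sum _ (fun j : ℕ => h.locInt_diffOp ht (a + j)) ⟨_, I, hI⟩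
  have hTpos : ∀ᵐ y ∂σ, (∑ j ∈ Finset.Ico k N, diffOp 𝒟 V W (a + j) y).IsPositive := by
    filter_upwards [h.isPositive_diffOp] with y hy
    exact isPositive_sum _ fun j _ => (hy _).1
  have h1 := ht e (N - k) ⟨a + k, I, hI⟩
  have h2 : ∫⁻ y in I, testSum 𝒟 V W e (a + k) (N - k) y ∂σ = ∫⁻ y in I, ENNReal.ofReal
      (form (∑ j ∈ Finset.Ico k N, diffOp 𝒟 V W (a + j) y) e) ∂σ := by
    refine lintegral_congr_ae ?_
    filter_upwards [ae_restrict_of_ae h.isPositive_diffOp] with y hy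
    rw [form_sum_left, Finset.sum_Ico_eq_sum_range,
      ENNReal.ofReal_sum_of_nonneg fun j _ => form_nonneg (hy _).1 e, testSum]
    refine Finset.sum_congr rfl fun j _ => ?_
    have e1 : a + k + ((j + 1 : ℕ) : ℤ) = a + ((k + j : ℕ) : ℤ) + 1 := by push_cast; ring
    have e2 : a + k + (j : ℤ) = a + ((k + j : ℕ) : ℤ) := by push_cast; ring
    rw [(hy _).2, e1, e2]
  simp only at h1
  rw [h2, setLIntegral_form_eq hI hTI hTpos, setLIntegral_form_eq hI (h.locInt_left ⟨_, I, hI⟩)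
    (h.posDef.mono fun _ h => h.isPositive), ← ENNReal.ofReal_mul hK.le] at h1
  have hIpos : 0 < σ.real I := ENNReal.toReal_pos hx hσI
  have hV0 := form_nonneg (isPositive_setAverage (h.locInt_left ⟨_, I, hI⟩)
    (h.posDef.mono fun _ h => h.isPositive)) e
  rw [ENNReal.ofReal_le_ofReal_iff (by positivity)] at h1
  rw [form_smul_left, inv_mul_le_iff₀ hK]
  refine le_of_mul_le_mul_left (h1.trans_eq ?_) hIpos
  simp only [avg, ← hIdef]
  ring

/-- The dimensional constant of the Carleson embedding theorem. -/
def carlesonConst (D : ℕ) : ℝ := 2 ^ (D + 1) * interpConst D ^ 2 * (D + 1) ^ 2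

theorem carlesonConst_nonneg (D : ℕ) : 0 ≤ carlesonConst D := by unfold carlesonConst; positivity

/-- The Carleson embedding theorem for the Carleson sequence given by the martingale differences of
`V`. The Bellman function of the raised weights gains the terms with `(⟨V⟩ + s M)⁻¹ ⟨f⟩` in place of
`⟨V⟩⁻¹ ⟨f⟩`; interpolation between several values of `s` recovers the latter. -/
theorem IsWeightPair.carleson (h : IsWeightPair 𝒟 V W A) (hK : 0 < K)
    (ht : TestingCondition 𝒟 V W K) {f : X → E} (hf : LocInt 𝒟 f) {a : ℤ} {J : Set X}
    (hJ : J ∈ 𝒟.D a) (N : ℕ) :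
    ∑ k ∈ Finset.range N, ∫⁻ x in J,
        ENNReal.ofReal (form (diffOp 𝒟 V W (a + k) x) (solve 𝒟 V f (a + k) x)) ∂σ ≤
      ENNReal.ofReal (carlesonConst (Module.finrank ℝ E) * K) *
        ∫⁻ x in J, ENNReal.ofReal (form (W x) (f x)) ∂σ := by
  set D := Module.finrank ℝ E with hD
  set R : Fin (D + 1) → ℕ → X → E →L[ℝ] E := fun i => raised 𝒟 V W a N (node D i / K) with hR
  have hdiff : ∀ n, LocInt 𝒟 (diffOp 𝒟 V W n) := h.locInt_diffOp ht
  have htpos : ∀ i, 0 < node D i / K := fun i => div_pos (node_pos D i) hK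
  have hRint : ∀ i k, LocInt 𝒟 (R i k) := fun i k =>
    locInt_add h.locInt_left (locInt_smul (locInt_sum _ fun j : ℕ => hdiff (a + j)) _)
  have hRpos : ∀ i k, ∀ᵐ x ∂σ, IsPosDef (R i k x) := by
    intro i k
    filter_upwards [h.posDef, h.isPositive_diffOp] with x hx hT
    exact hx.add_isPositive
      ((isPositive_sum _ fun j _ => (hT _).1).smul_of_nonneg (htpos i).le)
  have hTpos : ∀ i (k : ℕ), ∀ᵐ x ∂σ,
      ((node D i / K) • diffOp 𝒟 V W (a + k) x).IsPositive := fun i k =>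
    h.isPositive_diffOp.mono fun x hx => (hx _).1.smul_of_nonneg (htpos i).le
  -- the gain of the Bellman function of the raised weights
  have hgain (i : Fin (D + 1)) : ∑ k ∈ Finset.range N, ∫⁻ x in J,
      ENNReal.ofReal (form (diffOp 𝒟 V W (a + k) x) (solve 𝒟 (R i k) f (a + k) x)) ∂σ ≤
      ENNReal.ofReal ((D + 1) * K) * ∫⁻ x in J, ENNReal.ofReal (form (W x) (f x)) ∂σ := by
    have key := h.sum_bellman_le hf (a := a) (N := N) (R := R i)
      (T := fun k x => (node D i / K) • diffOp 𝒟 V W (a + k) x)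
      (by funext x; simp [hR, raised])
      (fun k hk => by
        funext x
        simp only [hR, raised]
        rw [Finset.sum_eq_sum_Ico_succ_bot hk, smul_add]
        abel)
      (hRint i) (fun k => locInt_smul (hdiff _) _) (hRpos i) (hTpos i) hJ
    refine le_trans ?_ (mul_le_mul_right key _)
    rw [Finset.mul_sum]
    refine Finset.sum_le_sum fun k _ => ?_
    rw [← lintegral_const_mul' _ _ ENNReal.ofReal_ne_top]
    refine lintegral_mono_ae ?_
    filter_upwards [ae_restrict_of_ae h.isPositive_diffOp,
      ae_restrict_of_ae (isPosDef_avg (hRint i (k + 1)) (hRpos i (k + 1)))] with x hx hx'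
    have h1 := form_nonneg (hx (a + k)).1 (solve 𝒟 (R i k) f (a + k) x)
    have h2 := form_nonneg (hx' (a + k + 1)).isPositive
      (solve 𝒟 (R i (k + 1)) f (a + k + 1) x - solve 𝒟 (R i k) f (a + k) x)
    rw [← ENNReal.ofReal_mul (by positivity)]
    refine ENNReal.ofReal_le_ofReal ?_
    rw [form_smul_left]
    have h3 : 1 ≤ (D + 1) * K * (node D i / K) := by
      have : (D + 1) * K * (node D i / K) = (i : ℝ) + 1 := by
        unfold node
        field_simp
      rw [this]
      simp
    have h4 : 0 ≤ (D + 1) * K * form (𝒟.avg (a + k + 1) (R i (k + 1)) x)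
      (solve 𝒟 (R i (k + 1)) f (a + k + 1) x - solve 𝒟 (R i k) f (a + k) x) := by positivity
    nlinarith [mul_le_mul_of_nonneg_right h3 h1]
  have hterm : ∀ k : ℕ, ∫⁻ x in J,
      ENNReal.ofReal (form (diffOp 𝒟 V W (a + k) x) (solve 𝒟 V f (a + k) x)) ∂σ ≤
      ENNReal.ofReal (2 ^ (D + 1) * interpConst D ^ 2) * ∑ i, ∫⁻ x in J,
        ENNReal.ofReal (form (diffOp 𝒟 V W (a + k) x) (solve 𝒟 (R i k) f (a + k) x)) ∂σ := by
    intro k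
    have hm (i : Fin (D + 1)) : AEMeasurable (fun x => ENNReal.ofReal
        (form (diffOp 𝒟 V W (a + k) x) (solve 𝒟 (R i k) f (a + k) x))) (σ.restrict J) :=
      aemeasurable_form (hdiff _ ⟨a, J, hJ⟩)
        (stronglyMeasurable_solve (R i k) f (a + k)).aestronglyMeasurable
    rw [← lintegral_finsetSum' _ fun i _ => hm i,
      ← lintegral_const_mul' _ _ ENNReal.ofReal_ne_top]
    refine lintegral_mono_ae ?_
    have hall : ∀ᵐ x ∂σ, ∀ i n, IsPosDef (𝒟.avg n (R i k) x) :=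
      ae_all_iff.2 fun i => isPosDef_avg (hRint i k) (hRpos i k)
    filter_upwards [ae_restrict_of_ae h.isPositive_diffOp, ae_restrict_of_ae hall,
      ae_restrict_of_ae h.posDef_avg,
      ae_restrict_of_ae (ae_measure_cell_ne_zero (𝒟 := 𝒟))] with x hx hRx hVx hx0
    have hTx := (hx (a + k)).1
    set M := K⁻¹ • 𝒟.avg (a + k) (fun y => ∑ j ∈ Finset.Ico k N, diffOp 𝒟 V W (a + j) y) x with hM
    have hMpos : M.IsPositive :=
      (isPositive_setAverage (locInt_sum _ (fun j : ℕ => hdiff (a + j))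
        ⟨_, _, 𝒟.cell_mem (a + k) x⟩) (h.isPositive_diffOp.mono fun y hy =>
          isPositive_sum _ fun j _ => (hy _).1)).smul_of_nonneg (inv_nonneg.2 hK.le)
    have havg (i : Fin (D + 1)) :
        𝒟.avg (a + k) (R i k) x = 𝒟.avg (a + k) V x + node D i • M := by
      have hRi : R i k = fun y => V y +
          (node D i / K) • ∑ j ∈ Finset.Ico k N, diffOp 𝒟 V W (a + j) y := rfl
      rw [hRi, avg_add h.locInt_left (locInt_smul (locInt_sum _ fun j : ℕ => hdiff (a + j)) _),
        avg_smul, hM, smul_smul, div_eq_mul_inv]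
    obtain ⟨κ, hκ, hsum⟩ := exists_interp hD.symm (hVx (a + k)) hMpos
      (h.form_avg_sum_le hK ht (hx0 (a + k))) (𝒟.avg (a + k) f x)
      (solve 𝒟 V f (a + k) x) (fun i => solve 𝒟 (R i k) f (a + k) x) (avg_solve (hVx _))
      (fun i => by rw [← havg]; exact avg_solve (hRx i _))
    rw [← ENNReal.ofReal_sum_of_nonneg fun i _ => form_nonneg hTx _,
      ← ENNReal.ofReal_mul (by positivity)]
    refine ENNReal.ofReal_le_ofReal ?_
    rw [hsum]
    refine (form_sum_le hTx _ _).trans ?_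
    rw [Finset.card_univ, Fintype.card_fin, mul_assoc]
    refine mul_le_mul_of_nonneg_left ?_ (by positivity)
    rw [Finset.mul_sum]
    refine Finset.sum_le_sum fun i _ => ?_
    rw [form_smul]
    refine mul_le_mul_of_nonneg_right ?_ (form_nonneg hTx _)
    exact sq_le_sq.2 ((hκ i).trans (le_abs_self _))
  calc _ ≤ ∑ k ∈ Finset.range N, ENNReal.ofReal (2 ^ (D + 1) * interpConst D ^ 2) *
        ∑ i, ∫⁻ x in J, ENNReal.ofReal
          (form (diffOp 𝒟 V W (a + k) x) (solve 𝒟 (R i k) f (a + k) x)) ∂σ :=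
        Finset.sum_le_sum fun k _ => hterm k
    _ = ENNReal.ofReal (2 ^ (D + 1) * interpConst D ^ 2) * ∑ i, ∑ k ∈ Finset.range N,
        ∫⁻ x in J, ENNReal.ofReal
          (form (diffOp 𝒟 V W (a + k) x) (solve 𝒟 (R i k) f (a + k) x)) ∂σ := by
        rw [← Finset.mul_sum, Finset.sum_comm]
    _ ≤ ENNReal.ofReal (2 ^ (D + 1) * interpConst D ^ 2) * ∑ _i : Fin (D + 1),
        ENNReal.ofReal ((D + 1) * K) * ∫⁻ x in J, ENNReal.ofReal (form (W x) (f x)) ∂σ := by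
        gcongr with i
        exact hgain i
    _ = _ := by
        rw [Finset.sum_const, Finset.card_univ, Fintype.card_fin, nsmul_eq_mul, ← mul_assoc,
          ← mul_assoc]
        congr 1
        rw [← ENNReal.ofReal_natCast, ← ENNReal.ofReal_mul (by positivity),
          ← ENNReal.ofReal_mul (by positivity), carlesonConst]
        congr 1
        push_cast
        ring

/-! ### The square function on one atom -/

/-- The square function estimate under the testing condition. The difference of consecutive averages
of `f` is split into the part given by the change of `g = ⟨V⟩⁻¹ ⟨f⟩`, which the convexity of the
Bellman function controls, and the part given by the change of `⟨V⟩`, which is a Carleson sum. -/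
theorem IsWeightPair.squareFunction_le (h : IsWeightPair 𝒟 V W A) (hK : 0 < K)
    (ht : TestingCondition 𝒟 V W K) {f : X → E} (hf : LocInt 𝒟 f) {a : ℤ} {J : Set X}
    (hJ : J ∈ 𝒟.D a) (N : ℕ) :
    ∑ k ∈ Finset.range N, ∫⁻ x in J,
        ENNReal.ofReal (form (W x) (𝒟.avg (a + k + 1) f x - 𝒟.avg (a + k) f x)) ∂σ ≤
      ENNReal.ofReal (2 * (A + carlesonConst (Module.finrank ℝ E) * K)) *
        ∫⁻ x in J, ENNReal.ofReal (form (W x) (f x)) ∂σ := by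
  have hA := h.nonneg
  have hbell := h.sum_bellman_le hf (a := a) (N := N) (R := fun _ => V) (T := fun _ _ => 0) rfl
    (fun k _ => by simp) (fun _ => h.locInt_left) (fun _ _ => integrableOn_zero)
    (fun _ => h.posDef) (fun _ => .of_forall fun _ => ContinuousLinearMap.isPositive_zero) hJ
  have hform0 (e : E) : form (0 : E →L[ℝ] E) e = 0 := by simp [form]
  simp only [hform0, zero_add] at hbell
  have hstep : ∀ k : ℕ, ∫⁻ x in J,
      ENNReal.ofReal (form (W x) (𝒟.avg (a + k + 1) f x - 𝒟.avg (a + k) f x)) ∂σ ≤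
      2 * (ENNReal.ofReal A * ∫⁻ x in J, ENNReal.ofReal (form (𝒟.avg (a + k + 1) V x)
        (solve 𝒟 V f (a + k + 1) x - solve 𝒟 V f (a + k) x)) ∂σ) +
      2 * ∫⁻ x in J,
        ENNReal.ofReal (form (diffOp 𝒟 V W (a + k) x) (solve 𝒟 V f (a + k) x)) ∂σ := by
    intro k
    have hJ1 : MeasurableSet[𝒟.ℱ (a + k + 1)] J := measurableSet_of_mem_le (by lia) hJ
    have hy : CellConst 𝒟 (a + k + 1)
        (fun x => solve 𝒟 V f (a + k + 1) x - solve 𝒟 V f (a + k) x) := by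
      intro I hI x hx y hy
      simp only
      rw [cellConst_solve V f (a + k + 1) I hI x hx y hy,
        (cellConst_solve V f (a + k)).mono (by lia) I hI x hx y hy]
    refine le_trans ?_ (add_le_add_left (mul_le_mul_right (h.setLIntegral_le hJ1 hy) 2) _)
    have hm : AEMeasurable (fun x => ENNReal.ofReal
        (form (diffOp 𝒟 V W (a + k) x) (solve 𝒟 V f (a + k) x))) (σ.restrict J) :=
      aemeasurable_form (h.locInt_diffOp ht _ ⟨a, J, hJ⟩)
        (stronglyMeasurable_solve V f (a + k)).aestronglyMeasurable
    rw [← lintegral_const_mul' _ _ (by norm_num), ← lintegral_const_mul' _ _ (by norm_num),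
      ← lintegral_add_right' _ (hm.const_mul 2)]
    refine lintegral_mono_ae ?_
    filter_upwards [ae_restrict_of_ae h.isPositive_diffOp, ae_restrict_of_ae h.posDef_avg,
      ae_restrict_of_ae h.isPositive] with x hx hV hW
    have e1 : 𝒟.avg (a + k + 1) f x - 𝒟.avg (a + k) f x =
        𝒟.avg (a + k + 1) V x (solve 𝒟 V f (a + k + 1) x - solve 𝒟 V f (a + k) x) +
        (𝒟.avg (a + k + 1) V x - 𝒟.avg (a + k) V x) (solve 𝒟 V f (a + k) x) := by
      rw [map_sub, sub_apply, avg_solve (hV _), avg_solve (hV _)]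
      abel
    rw [(hx _).2, e1]
    refine (ENNReal.ofReal_le_ofReal (form_add_le hW _ _)).trans ?_
    have h1 := form_nonneg hW
      (𝒟.avg (a + k + 1) V x (solve 𝒟 V f (a + k + 1) x - solve 𝒟 V f (a + k) x))
    have h2 := form_nonneg hW
      ((𝒟.avg (a + k + 1) V x - 𝒟.avg (a + k) V x) (solve 𝒟 V f (a + k) x))
    rw [ENNReal.ofReal_add (by positivity) (by positivity), ENNReal.ofReal_mul (by norm_num),
      ENNReal.ofReal_mul (by norm_num), ENNReal.ofReal_ofNat]
  have hcar := h.carleson hK ht hf hJ N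
  refine (Finset.sum_le_sum fun k _ => hstep k).trans ?_
  rw [Finset.sum_add_distrib, ← Finset.mul_sum, ← Finset.mul_sum, ← Finset.mul_sum]
  have hc := carlesonConst_nonneg (Module.finrank ℝ E)
  rw [ENNReal.ofReal_mul (by norm_num), ENNReal.ofReal_add hA (by positivity),
    ENNReal.ofReal_ofNat, mul_assoc, add_mul, mul_add]
  gcongr

end

/-! ### From atoms to the whole space -/

section

open AtomicFiltration

variable {X : Type v} [MeasurableSpace X] {σ : Measure X} {𝒟 : AtomicFiltration σ}

theorem LocInt.aestronglyMeasurable {F : Type*} [NormedAddCommGroup F] {f : X → F}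
    (hf : LocInt 𝒟 f) : AEStronglyMeasurable f σ := by
  have hA : Set.univ = ⋃ I ∈ {I ∈ 𝒟.D 0 | I ⊆ Set.univ}, I := eq_biUnion_atoms MeasurableSet.univ
  have hc := (countable_atoms (𝒟 := 𝒟) 0 Set.univ).to_subtype
  rw [Set.biUnion_eq_iUnion] at hA
  rw [← Measure.restrict_univ (μ := σ), hA, aestronglyMeasurable_iUnion_iff]
  exact fun I => (hf ⟨0, I.1, I.2.1⟩).aestronglyMeasurable

section WeightPair

variable {E : Type*} [NormedAddCommGroup E] [InnerProductSpace ℝ E]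
variable {V W : X → E →L[ℝ] E} {A K : ℝ} {f : X → E}

theorem IsWeightPair.aemeasurable_form (h : IsWeightPair 𝒟 V W A)
    (hf : AEStronglyMeasurable f σ) :
    AEMeasurable (fun x => ENNReal.ofReal (form (W x) (f x))) σ :=
  (continuous_form.comp_aestronglyMeasurable
    (h.locInt_right.aestronglyMeasurable.prodMk hf)).aemeasurable.ennreal_ofReal

theorem IsWeightPair.form_left_apply (h : IsWeightPair 𝒟 V W A) :
    ∀ᵐ x ∂σ, ∀ e, form (V x) (W x e) = form (W x) e := by
  filter_upwards [h.inverse] with x hx e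
  rw [form, hx, form, real_inner_comm]

/-- A function of norm zero in the weighted space vanishes almost everywhere. -/
theorem IsWeightPair.ae_eq_zero (h : IsWeightPair 𝒟 V W A) (hf : AEStronglyMeasurable f σ)
    (h0 : ∫⁻ x, ENNReal.ofReal (form (W x) (f x)) ∂σ = 0) : f =ᵐ[σ] 0 := by
  rw [lintegral_eq_zero_iff' (h.aemeasurable_form hf)] at h0
  filter_upwards [h0, h.posDef, h.inverse, h.form_left_apply] with x hx hV hinv hVW
  simp only [Pi.zero_apply, ENNReal.ofReal_eq_zero] at hx
  have h1 : W x (f x) = 0 := by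
    by_contra hne
    have := hV.form_pos _ hne
    rw [hVW] at this
    linarith
  rw [← hinv (f x), h1, map_zero, Pi.zero_apply]

variable [FiniteDimensional ℝ E]

/-- Functions of the weighted space are locally integrable: pairing `f = V (W f)` with a vector `b`
is bounded by `(V b, b) + (W f, f)`. -/
theorem IsWeightPair.locInt_of_lintegral_lt_top (h : IsWeightPair 𝒟 V W A)
    (hf : AEStronglyMeasurable f σ)
    (hfin : ∫⁻ x, ENNReal.ofReal (form (W x) (f x)) ∂σ < ∞) : LocInt 𝒟 f := by
  intro I
  have hform : Integrable (fun x => form (W x) (f x)) σ := by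
    refine ⟨continuous_form.comp_aestronglyMeasurable
      (h.locInt_right.aestronglyMeasurable.prodMk hf), ?_⟩
    rw [hasFiniteIntegral_iff_ofReal (h.isPositive.mono fun x hx => form_nonneg hx _)]
    exact hfin
  set b := stdOrthonormalBasis ℝ E
  have hg : IntegrableOn (fun x => ∑ i, (form (V x) (b i) + form (W x) (f x))) I.set σ :=
    integrable_finsetSum _ fun i _ =>
      (integrableOn_form (h.locInt_left I) (b i)).add hform.integrableOn
  refine Integrable.mono' hg hf.restrict (ae_restrict_of_ae ?_)
  filter_upwards [h.posDef, h.isPositive, h.inverse, h.form_left_apply] with x hV hW hx hVW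
  calc ‖f x‖ = ‖∑ i, (inner ℝ (b i) (f x) : ℝ) • b i‖ := by rw [b.sum_repr']
    _ ≤ ∑ i, ‖(inner ℝ (b i) (f x) : ℝ) • b i‖ := norm_sum_le _ _
    _ ≤ _ := by
      refine Finset.sum_le_sum fun i _ => ?_
      rw [norm_smul, b.orthonormal.1 i, mul_one, Real.norm_eq_abs, real_inner_comm]
      have h1 := abs_inner_le_of_isPositive hV.isPositive (W x (f x)) (b i)
      rw [hx, hVW] at h1
      have h2 := form_nonneg hW (f x)
      have h3 := form_nonneg hV.isPositive (b i)
      linarith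

/-- The `A₂` constant is positive as soon as there is an atom of positive measure and a nonzero
vector. -/
theorem IsWeightPair.pos (h : IsWeightPair 𝒟 V W A) {J : Atom 𝒟} (hJ : σ J.set ≠ 0) {e : E}
    (he : e ≠ 0) : 0 < A := by
  have hJt := measure_ne_top J.mem
  have hWpos : ∀ᵐ x ∂σ, IsPosDef (W x) := by
    filter_upwards [h.isPositive, h.posDef, h.inverse, h.form_left_apply] with x hW hV hinv hVW
    refine ⟨hW, fun y hy => ?_⟩
    rw [← hVW]
    refine hV.form_pos _ fun h0 => hy ?_
    rw [← hinv y, h0, map_zero]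
  have hV := isPosDef_setAverage (h.locInt_left J) h.posDef hJ hJt
  have hW := isPosDef_setAverage (h.locInt_right J) hWpos hJ hJt
  have h1 := hV.form_pos e he
  have h2 : (⨍ x in J.set, V x ∂σ) e ≠ 0 := fun h0 => by simp [form, h0] at h1
  have h3 := (hW.form_pos _ h2).trans_le (h.a2 J e)
  exact pos_of_mul_pos_left h3 h1.le

theorem one_le_scalarAInfChar {w : X → ℝ} {J : Atom 𝒟} (hJ : σ J.set ≠ 0)
    (hw : 0 < ⨍ x in J.set, w x ∂σ) : 1 ≤ scalarAInfChar 𝒟 w := by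
  refine le_sInf fun C hC => ?_
  have hJt := measure_ne_top J.mem
  set a := ⨍ x in J.set, w x ∂σ
  have h1 : ENNReal.ofReal a ≤ ⨍⁻ x in J.set, localMax J w x ∂σ := by
    have hc : ⨍⁻ _ in J.set, ENNReal.ofReal a ∂σ = ENNReal.ofReal a :=
      setLAverage_const hJ hJt _
    rw [← hc, setLAverage_eq, setLAverage_eq]
    gcongr ?_ / _
    refine setLIntegral_mono' (measurableSet_of_mem J.mem) fun x hx => ?_
    rw [← Real.enorm_of_nonneg hw.le]
    exact enorm_average_le_localMax J w hx
  have h2 := h1.trans (hC J)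
  by_contra! hlt
  refine absurd h2 (not_le.2 ?_)
  calc C * ENNReal.ofReal a < 1 * ENNReal.ofReal a :=
        ENNReal.mul_lt_mul_left (by simpa using hw) ENNReal.ofReal_ne_top hlt
    _ = _ := one_mul _

/-- A bound for the `A_∞` characteristics of the scalar weights `(V e, e)` turns the testing
inequality for the maximal function into the testing condition. -/
theorem IsWeightPair.testingCondition (h : IsWeightPair 𝒟 V W A) {Q : ℝ}
    (hV : ∀ e, scalarAInfChar 𝒟 (fun x => form (V x) e) < ENNReal.ofReal Q) :
    TestingCondition 𝒟 V W (testConst (Module.finrank ℝ E) * A * Q) := by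
  intro e m J
  obtain ⟨C, hC, hCQ⟩ := sInf_lt_iff.1 (hV e)
  have hJt := measure_ne_top J.mem
  have hc := testConst_nonneg (Module.finrank ℝ E)
  have hA := h.nonneg
  have hM : ∫⁻ x in J.set, localMax J (fun x => form (V x) e) x ∂σ ≤
      ENNReal.ofReal Q * ∫⁻ x in J.set, ENNReal.ofReal (form (V x) e) ∂σ := by
    have hint : σ J.set * ENNReal.ofReal (⨍ x in J.set, form (V x) e ∂σ) =
        ∫⁻ x in J.set, ENNReal.ofReal (form (V x) e) ∂σ := by
      rw [← ofReal_integral_eq_lintegral_ofReal (integrableOn_form (h.locInt_left J) e)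
        (ae_restrict_of_ae (h.posDef.mono fun x hx => form_nonneg hx.isPositive e)),
        ← measureReal_smul_setAverage J.mem, smul_eq_mul, ENNReal.ofReal_mul measureReal_nonneg,
        ofReal_measureReal hJt]
    calc _ = σ J.set * ⨍⁻ x in J.set, localMax J (fun x => form (V x) e) x ∂σ :=
          (measure_mul_setLAverage _ hJt).symm
      _ ≤ σ J.set * (ENNReal.ofReal Q * ENNReal.ofReal (⨍ x in J.set, form (V x) e ∂σ)) := by
          gcongr
          exact (hC J).trans (by gcongr)
      _ = _ := by rw [← hint]; ring
  refine (h.testing e m J).trans ?_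
  rw [ENNReal.ofReal_mul (mul_nonneg hc hA), mul_assoc]
  gcongr

/-- The square function estimate on the whole space, summed over all generations. -/
theorem IsWeightPair.tsum_lintegral_le (h : IsWeightPair 𝒟 V W A) (hK : 0 < K)
    (ht : TestingCondition 𝒟 V W K) (hf : LocInt 𝒟 f) :
    ∑' n : ℤ, ∫⁻ x, ENNReal.ofReal (form (W x) (𝒟.avg (n + 1) f x - 𝒟.avg n f x)) ∂σ ≤
      ENNReal.ofReal (2 * (A + carlesonConst (Module.finrank ℝ E) * K)) *
        ∫⁻ x, ENNReal.ofReal (form (W x) (f x)) ∂σ := by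
  rw [ENNReal.tsum_eq_iSup_sum]
  refine iSup_le fun s => ?_
  obtain ⟨a, ha⟩ := s.bddBelow
  obtain ⟨b, hb⟩ := s.bddAbove
  set N := (b + 1 - a).toNat with hN
  set φ : ℤ → X → ℝ≥0∞ :=
    fun n x => ENNReal.ofReal (form (W x) (𝒟.avg (n + 1) f x - 𝒟.avg n f x)) with hφ
  have hm (n : ℤ) : AEMeasurable (φ n) σ := h.aemeasurable_form
    ((stronglyMeasurable_avg _ f).sub (stronglyMeasurable_avg _ f)).aestronglyMeasurable
  have hinj : Function.Injective fun k : ℕ => a + (k : ℤ) := fun k l hkl => by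
    simpa using hkl
  have hs : s ⊆ (Finset.range N).map ⟨_, hinj⟩ := by
    intro n hn
    have h1 := ha hn
    have h2 := hb hn
    rw [Finset.mem_map]
    refine ⟨(n - a).toNat, Finset.mem_range.2 (by lia), ?_⟩
    simp only [Function.Embedding.coeFn_mk]
    lia
  refine (Finset.sum_le_sum_of_subset hs).trans ?_
  rw [Finset.sum_map, ← lintegral_finsetSum' _ fun k _ => hm _,
    ← lintegral_const_mul' _ _ ENNReal.ofReal_ne_top,
    ← setLIntegral_univ, ← setLIntegral_univ (f := fun x => _ * _)]
  refine setLIntegral_mono_of_atoms (𝒟 := 𝒟) (n := a) MeasurableSet.univ fun J hJ _ => ?_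
  rw [lintegral_finsetSum' _ fun k _ => (hm _).restrict,
    lintegral_const_mul' _ _ ENNReal.ofReal_ne_top]
  exact h.squareFunction_le hK ht hf hJ N

end WeightPair

end

/-! ### Matrices as operators on a real inner product space -/

section

open AtomicFiltration

variable {X : Type v} [MeasurableSpace X] {σ : Measure X} {𝒟 : AtomicFiltration σ}
variable {𝕜 : Type u} [RCLike 𝕜] {d : ℕ}

section Comp

variable {F G : Type*} [NormedAddCommGroup F] [NormedSpace ℝ F] [FiniteDimensional ℝ F]
  [NormedAddCommGroup G] [NormedSpace ℝ G]

theorem locInt_linearMap_comp (L : F →ₗ[ℝ] G) {f : X → F} (hf : LocInt 𝒟 f) :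
    LocInt 𝒟 fun x => L (f x) := fun I => L.toContinuousLinearMap.integrable_comp (hf I)

theorem setAverage_linearMap_comp [CompleteSpace G] (L : F →ₗ[ℝ] G) {f : X → F}
    (hf : LocInt 𝒟 f) (I : Atom 𝒟) :
    ⨍ x in I.set, L (f x) ∂σ = L (⨍ x in I.set, f x ∂σ) := by
  have := FiniteDimensional.complete ℝ F
  have h := L.toContinuousLinearMap.integral_comp_comm (hf I)
  simp only [LinearMap.coe_toContinuousLinearMap'] at h
  rw [setAverage_eq, setAverage_eq, h, map_smul]

theorem setAverage_sum {ι : Type*} (s : Finset ι) {f : ι → X → G} (hf : ∀ i, LocInt 𝒟 (f i))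
    (I : Atom 𝒟) : ⨍ x in I.set, ∑ i ∈ s, f i x ∂σ = ∑ i ∈ s, ⨍ x in I.set, f i x ∂σ := by
  simp_rw [setAverage_eq]
  rw [integral_finsetSum _ fun i _ => hf i I, Finset.smul_sum]

end Comp

theorem real_inner_eq_re (x y : EuclideanSpace 𝕜 (Fin d)) :
    (inner ℝ x y : ℝ) = RCLike.re (inner 𝕜 x y) := by
  simp only [PiLp.inner_apply]
  rw [map_sum]
  rfl

/-- The operator of a matrix over `ℝ` or `ℂ` on the underlying real inner product space. -/
def realOp (M : Matrix (Fin d) (Fin d) 𝕜) :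
    EuclideanSpace 𝕜 (Fin d) →L[ℝ] EuclideanSpace 𝕜 (Fin d) :=
  (Matrix.toEuclideanCLM (n := Fin d) (𝕜 := 𝕜) M).restrictScalars ℝ

theorem realOp_apply (M : Matrix (Fin d) (Fin d) 𝕜) (e : EuclideanSpace 𝕜 (Fin d)) :
    realOp M e = Matrix.toEuclideanCLM (n := Fin d) (𝕜 := 𝕜) M e := rfl

theorem form_realOp (M : Matrix (Fin d) (Fin d) 𝕜) (e : EuclideanSpace 𝕜 (Fin d)) :
    form (realOp M) e = quadForm M e := by
  rw [form, real_inner_comm, real_inner_eq_re, realOp_apply, quadForm]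

theorem realOp_mul_apply (M N : Matrix (Fin d) (Fin d) 𝕜) (e : EuclideanSpace 𝕜 (Fin d)) :
    realOp (M * N) e = realOp M (realOp N e) := by
  simp only [realOp_apply, map_mul]
  rfl

/-- `realOp` as a real linear map. -/
def realOpₗ : Matrix (Fin d) (Fin d) 𝕜 →ₗ[ℝ]
    (EuclideanSpace 𝕜 (Fin d) →L[ℝ] EuclideanSpace 𝕜 (Fin d)) where
  toFun := realOp
  map_add' M N := by
    ext1 e
    simp [realOp_apply]
  map_smul' r M := by
    ext1 e
    have h : r • M = (r : 𝕜) • M := by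
      ext i j
      simp [RCLike.real_smul_eq_coe_mul]
    have h2 (y : EuclideanSpace 𝕜 (Fin d)) : r • y = (r : 𝕜) • y := by
      ext i
      simp [RCLike.real_smul_eq_coe_mul]
    rw [realOp_apply, h, map_smul, RingHom.id_apply, smul_apply, smul_apply, h2, realOp_apply]

/-- The contribution of one entry to `realOp`. -/
def entryOp (i j : Fin d) :
    𝕜 →ₗ[ℝ] (EuclideanSpace 𝕜 (Fin d) →L[ℝ] EuclideanSpace 𝕜 (Fin d)) :=
  realOpₗ ∘ₗ Matrix.singleLinearMap ℝ i j

theorem realOp_eq_sum (M : Matrix (Fin d) (Fin d) 𝕜) :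
    realOp M = ∑ i, ∑ j, entryOp i j (M i j) := by
  have h : realOp M = realOpₗ M := rfl
  rw [h]
  conv_lhs => rw [Matrix.matrix_eq_sum_single M]
  simp only [map_sum]
  rfl

variable {W : X → Matrix (Fin d) (Fin d) 𝕜}

theorem locInt_entryOp (hW : ∀ i j, LocInt 𝒟 fun x => W x i j) (i j : Fin d) :
    LocInt 𝒟 fun x => entryOp i j (W x i j) := 
  locInt_linearMap_comp (F := 𝕜) (G := EuclideanSpace 𝕜 (Fin d) →L[ℝ] EuclideanSpace 𝕜 (Fin d))
    (entryOp i j) (hW i j)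

theorem locInt_realOp (hW : ∀ i j, LocInt 𝒟 fun x => W x i j) :
    LocInt 𝒟 fun x => realOp (W x) := by
  simp_rw [realOp_eq_sum]
  exact locInt_sum _ fun i => locInt_sum _ fun j => locInt_entryOp hW i j

theorem realOp_matAvg (hW : ∀ i j, LocInt 𝒟 fun x => W x i j) (I : Atom 𝒟) :
    realOp (matAvg σ W I.set) = ⨍ x in I.set, realOp (W x) ∂σ := by
  simp_rw [realOp_eq_sum]
  rw [setAverage_sum _ (fun i => locInt_sum _ fun j => locInt_entryOp hW i j)]
  refine Finset.sum_congr rfl fun i _ => ?_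
  rw [setAverage_sum _ fun j => locInt_entryOp hW i j]
  refine Finset.sum_congr rfl fun j _ => ?_
  exact (setAverage_linearMap_comp (F := 𝕜)
    (G := EuclideanSpace 𝕜 (Fin d) →L[ℝ] EuclideanSpace 𝕜 (Fin d)) (entryOp i j) (hW i j) I).symm

theorem isPositive_realOp_iff {M : Matrix (Fin d) (Fin d) 𝕜} :
    (realOp M).IsPositive ↔ M.PosSemidef := by
  rw [← Matrix.isPositive_toEuclideanLin_iff, ← Matrix.coe_toEuclideanCLM_eq_toEuclideanLin]
  constructor
  · intro h
    have hre (x y : EuclideanSpace 𝕜 (Fin d)) :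
        RCLike.re (inner 𝕜 (Matrix.toEuclideanCLM (n := Fin d) (𝕜 := 𝕜) M x) y) =
          RCLike.re (inner 𝕜 x (Matrix.toEuclideanCLM (n := Fin d) (𝕜 := 𝕜) M y)) := by
      rw [← real_inner_eq_re, ← real_inner_eq_re]
      exact h.1 x y
    refine ⟨fun x y => RCLike.ext (hre x y) ?_, fun x => ?_⟩
    · have := hre x ((RCLike.I : 𝕜) • y)
      simp only [map_smul, inner_smul_right, RCLike.I_mul_re, neg_inj] at this
      exact this
    · have := h.2 x
      rw [ContinuousLinearMap.reApplyInnerSelf_apply] at this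
      rw [← real_inner_eq_re]
      exact this
  · intro h
    refine ⟨fun x y => ?_, fun x => ?_⟩
    · have := h.1 x y
      simp only [ContinuousLinearMap.coe_coe] at this ⊢
      rw [real_inner_eq_re, real_inner_eq_re, realOp_apply, realOp_apply, this]
    · rw [ContinuousLinearMap.reApplyInnerSelf_apply]
      have := h.2 x
      rw [← real_inner_eq_re] at this
      exact this

theorem isPosDef_realOp {M : Matrix (Fin d) (Fin d) 𝕜} (hM : M.PosSemidef) (hu : IsUnit M) :
    IsPosDef (realOp M) := by
  refine ⟨isPositive_realOp_iff.2 hM, fun e he => ?_⟩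
  have h := (hM.posDef_iff_isUnit.2 hu).re_dotProduct_pos (x := WithLp.ofLp e)
    (by simpa using he)
  rw [form_realOp, quadForm, EuclideanSpace.inner_eq_star_dotProduct, dotProduct_comm]
  exact h

/-- The quadratic form of a positive semidefinite matrix through its square root. -/
theorem norm_sqrt_sq {M : Matrix (Fin d) (Fin d) 𝕜} (hM : M.PosSemidef)
    (e : EuclideanSpace 𝕜 (Fin d)) : ‖realOp (CFC.sqrt M) e‖ ^ 2 = form (realOp M) e := by
  have hs : (realOp (CFC.sqrt M)).IsPositive :=
    isPositive_realOp_iff.2 (Matrix.nonneg_iff_posSemidef.1 (CFC.sqrt_nonneg M))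
  conv_rhs => rw [← CFC.sqrt_mul_sqrt_self M hM.nonneg]
  rw [form, realOp_mul_apply, inner_symm_of_isPositive hs, real_inner_self_eq_norm_sq]

theorem posSemidef_matAvg (hW : IsMatrixWeight 𝒟 W) (I : Atom 𝒟) :
    (matAvg σ W I.set).PosSemidef := by
  rw [← isPositive_realOp_iff, realOp_matAvg hW.locInt]
  exact isPositive_setAverage (locInt_realOp hW.locInt I)
    (hW.posSemidef.mono fun x hx => isPositive_realOp_iff.2 hx)

/-- A matrix `A₂` weight and its inverse form a pair of dual operator weights. -/
theorem IsA2Weight.isWeightPair (h : IsA2Weight 𝒟 W) :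
    IsWeightPair 𝒟 (fun x => realOp (W x)⁻¹) (fun x => realOp (W x)) (A2Char 𝒟 W).toReal where
  nonneg := ENNReal.toReal_nonneg
  locInt_left := locInt_realOp h.weight_inv.locInt
  locInt_right := locInt_realOp h.weight.locInt
  posDef := by
    filter_upwards [h.weight_inv.posSemidef, h.invertible] with x hx hu
    refine isPosDef_realOp hx ?_
    rw [Matrix.isUnit_nonsing_inv_iff]
    exact hu
  isPositive := h.weight.posSemidef.mono fun x hx => isPositive_realOp_iff.2 hx
  inverse := by
    filter_upwards [h.invertible] with x hu e
    rw [← realOp_mul_apply, Matrix.nonsing_inv_mul _ ((Matrix.isUnit_iff_isUnit_det _).1 hu),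
      realOp_apply, map_one]
    rfl
  a2 I e := by
    have hWI := posSemidef_matAvg h.weight I
    have hVI := posSemidef_matAvg h.weight_inv I
    rw [← realOp_matAvg h.weight.locInt, ← realOp_matAvg h.weight_inv.locInt]
    set WI := matAvg σ W I.set
    set VI := matAvg σ (fun x => (W x)⁻¹) I.set
    have h1 : (opNorm (CFC.sqrt WI * CFC.sqrt VI) ^ 2).toReal ≤ (A2Char 𝒟 W).toReal :=
      ENNReal.toReal_mono h.finite.ne (le_iSup (fun I : Atom 𝒟 =>
        opNorm (CFC.sqrt (matAvg σ W I.set) *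
          CFC.sqrt (matAvg σ (fun x => (W x)⁻¹) I.set)) ^ 2) I)
    have h2 : realOp VI e = realOp (CFC.sqrt VI) (realOp (CFC.sqrt VI) e) := by
      rw [← realOp_mul_apply, CFC.sqrt_mul_sqrt_self VI hVI.nonneg]
    rw [← norm_sqrt_sq hWI, ← norm_sqrt_sq hVI, h2, ← realOp_mul_apply]
    have h3 : ‖realOp (CFC.sqrt WI * CFC.sqrt VI) (realOp (CFC.sqrt VI) e)‖ ≤
        (opNorm (CFC.sqrt WI * CFC.sqrt VI)).toReal * ‖realOp (CFC.sqrt VI) e‖ := by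
      rw [opNorm, toReal_enorm, realOp_apply]
      exact ContinuousLinearMap.le_opNorm _ _
    calc _ ≤ ((opNorm (CFC.sqrt WI * CFC.sqrt VI)).toReal * ‖realOp (CFC.sqrt VI) e‖) ^ 2 := by
          gcongr
      _ = (opNorm (CFC.sqrt WI * CFC.sqrt VI) ^ 2).toReal * ‖realOp (CFC.sqrt VI) e‖ ^ 2 := by
          rw [mul_pow, ENNReal.toReal_pow]
      _ ≤ _ := by gcongr

end

/-! ### The square function in terms of averages -/

section

open AtomicFiltration

variable {X : Type v} [MeasurableSpace X] {σ : Measure X} {𝒟 : AtomicFiltration σ}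

/-- On an atom the martingale difference is the difference of two consecutive averages. -/
theorem martDiff_of_mem {E : Type*} [NormedAddCommGroup E] [NormedSpace ℝ E] {I : Atom 𝒟}
    (f : X → E) {x : X} (hx : x ∈ I.set) :
    martDiff I f x = 𝒟.avg (I.rk + 1) f x - 𝒟.avg I.rk f x := by
  have hmeas : MeasurableSet[𝒟.ℱ (I.rk + 1)] I.set := measurableSet_of_mem_le (by lia) I.mem
  let c : I.children := ⟨⟨I.rk + 1, 𝒟.cell (I.rk + 1) x, 𝒟.cell_mem _ x⟩,
    cell_subset hmeas hx, rfl⟩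
  rw [martDiff, tsum_eq_single c, Set.indicator_of_mem hx, avg_eq I.mem hx,
    Set.indicator_of_mem (𝒟.mem_cell _ x)]
  · rfl
  · rintro ⟨⟨n, J, hJ⟩, hJI, hn⟩ hne
    refine Set.indicator_of_notMem (fun hxJ => hne ?_) _
    change n = I.rk + 1 at hn
    subst hn
    have hc : J = 𝒟.cell (I.rk + 1) x := (cell_eq hJ hxJ).symm
    subst hc
    rfl

theorem martDiff_of_notMem {E : Type*} [NormedAddCommGroup E] [NormedSpace ℝ E] {I : Atom 𝒟}
    (f : X → E) {x : X} (hx : x ∉ I.set) : martDiff I f x = 0 := by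
  rw [martDiff, Set.indicator_of_notMem hx, sub_zero]
  refine (tsum_congr fun J : I.children => ?_).trans tsum_zero
  exact Set.indicator_of_notMem (fun h => hx (J.2.1 h)) _

section Matrix

variable {𝕜 : Type u} [RCLike 𝕜] {d : ℕ} {W : X → Matrix (Fin d) (Fin d) 𝕜}
  {f : X → EuclideanSpace 𝕜 (Fin d)}

theorem squareFn_sq {x : X} (hx : (W x).PosSemidef) :
    squareFn 𝒟 W f x ^ (2 : ℝ) =
      ∑' n : ℤ, ENNReal.ofReal (form (realOp (W x)) (𝒟.avg (n + 1) f x - 𝒟.avg n f x)) := by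
  rw [squareFn, ← ENNReal.rpow_mul, one_div, inv_mul_cancel₀ two_ne_zero, ENNReal.rpow_one]
  let g : ℤ → Atom 𝒟 := fun n => ⟨n, 𝒟.cell n x, 𝒟.cell_mem n x⟩
  have hg : Function.Injective g := fun n m h => congrArg Atom.rk h
  rw [← hg.tsum_eq]
  · refine tsum_congr fun n => ?_
    rw [martDiff_of_mem f (𝒟.mem_cell n x), ← norm_sqrt_sq hx, ENNReal.ofReal_pow (norm_nonneg _),
      ofReal_norm]
    rfl
  · intro I hI
    have hxI : x ∈ I.set := by
      by_contra hxI
      simp [martDiff_of_notMem f hxI] at hI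
    refine ⟨I.rk, ?_⟩
    obtain ⟨n, J, hJ⟩ := I
    simp only [g, Atom.mk.injEq, true_and]
    exact cell_eq hJ hxI

theorem eLpNorm_squareFn_eq (h : IsA2Weight 𝒟 W) :
    eLpNorm (squareFn 𝒟 W f) 2 σ = (∑' n : ℤ, ∫⁻ x, ENNReal.ofReal
      (form (realOp (W x)) (𝒟.avg (n + 1) f x - 𝒟.avg n f x)) ∂σ) ^ (1 / 2 : ℝ) := by
  rw [eLpNorm_eq_lintegral_rpow_enorm_toReal two_ne_zero ENNReal.ofNat_ne_top,
    ENNReal.toReal_ofNat]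
  congr 1
  have hm (n : ℤ) : AEMeasurable (fun x => ENNReal.ofReal
      (form (realOp (W x)) (𝒟.avg (n + 1) f x - 𝒟.avg n f x))) σ :=
    h.isWeightPair.aemeasurable_form
      ((stronglyMeasurable_avg _ f).sub (stronglyMeasurable_avg _ f)).aestronglyMeasurable
  rw [← lintegral_tsum hm]
  refine lintegral_congr_ae ?_
  filter_upwards [h.weight.posSemidef] with x hx
  rw [enorm_eq_self, squareFn_sq hx]

theorem normL2W_eq : normL2W σ W f =
    (∫⁻ x, ENNReal.ofReal (form (realOp (W x)) (f x)) ∂σ) ^ (1 / 2 : ℝ) := by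
  simp only [normL2W, form_realOp]

theorem finrank_euclideanSpace_le :
    Module.finrank ℝ (EuclideanSpace 𝕜 (Fin d)) ≤ 2 * d := by
  rw [← Module.finrank_mul_finrank ℝ 𝕜 (EuclideanSpace 𝕜 (Fin d)), finrank_euclideanSpace_fin]
  gcongr
  exact RCLike.finrank_le_two 𝕜

/-- The constant of the square function estimate in real dimension `D`. -/
def sqConst (D : ℕ) : ℝ := 2 * (1 + 2 * carlesonConst D * testConst D)

theorem sqConst_pos (D : ℕ) : 0 < sqConst D := by
  have h1 := carlesonConst_nonneg D
  have h2 := testConst_nonneg D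
  unfold sqConst
  positivity

/-- If the weighted space contains a function of positive norm, then there are an atom of positive
measure and a nonzero vector. -/
theorem exists_atom_ne_zero
    (h0 : ∫⁻ x, ENNReal.ofReal (form (realOp (W x)) (f x)) ∂σ ≠ 0) :
    ∃ J : Atom 𝒟, σ J.set ≠ 0 ∧ ∃ e : EuclideanSpace 𝕜 (Fin d), e ≠ 0 := by
  by_contra! hcon
  refine h0 (le_antisymm ?_ zero_le)
  rw [← setLIntegral_univ, ← lintegral_zero (μ := σ.restrict Set.univ)]
  refine setLIntegral_mono_of_atoms (𝒟 := 𝒟) (n := 0) MeasurableSet.univ fun I hI _ => ?_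
  by_cases h1 : σ I = 0
  · rw [setLIntegral_measure_zero _ _ h1]
    exact zero_le
  · simp [hcon ⟨0, I, hI⟩ h1]

theorem IsA2Weight.a2Char_pos (h : IsA2Weight 𝒟 W)
    (h0 : ∫⁻ x, ENNReal.ofReal (form (realOp (W x)) (f x)) ∂σ ≠ 0) : 0 < A2Char 𝒟 W := by
  obtain ⟨J, hJ, e, he⟩ := exists_atom_ne_zero (𝒟 := 𝒟) h0
  exact (ENNReal.toReal_pos_iff.1 (h.isWeightPair.pos hJ he)).1

/-- The square function estimate in the case of a finite `A_∞` characteristic and a function of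
positive norm. -/
theorem IsA2Weight.tsum_lintegral_le (h : IsA2Weight 𝒟 W) (hf : LocInt 𝒟 f)
    (h0 : ∫⁻ x, ENNReal.ofReal (form (realOp (W x)) (f x)) ∂σ ≠ 0)
    (hQ : AInfChar 𝒟 (fun x => (W x)⁻¹) ≠ ∞) :
    ∑' n : ℤ, ∫⁻ x, ENNReal.ofReal
        (form (realOp (W x)) (𝒟.avg (n + 1) f x - 𝒟.avg n f x)) ∂σ ≤
      ENNReal.ofReal (sqConst (Module.finrank ℝ (EuclideanSpace 𝕜 (Fin d)))) * A2Char 𝒟 W *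
        AInfChar 𝒟 (fun x => (W x)⁻¹) * ∫⁻ x, ENNReal.ofReal (form (realOp (W x)) (f x)) ∂σ := by
  have hp := h.isWeightPair
  obtain ⟨J, hJ, e, he⟩ := exists_atom_ne_zero (𝒟 := 𝒟) h0
  set D := Module.finrank ℝ (EuclideanSpace 𝕜 (Fin d))
  set A := (A2Char 𝒟 W).toReal with hAdef
  set q := (AInfChar 𝒟 fun x => (W x)⁻¹).toReal with hq
  have hA : 0 < A := hp.pos hJ he
  have hform (e : EuclideanSpace 𝕜 (Fin d)) :
      (fun x => form (realOp (W x)⁻¹) e) = fun x => quadForm (W x)⁻¹ e :=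
    funext fun x => form_realOp _ e
  have hle (e : EuclideanSpace 𝕜 (Fin d)) :
      scalarAInfChar 𝒟 (fun x => form (realOp (W x)⁻¹) e) ≤ AInfChar 𝒟 fun x => (W x)⁻¹ := by
    rw [hform]
    exact le_iSup (fun e => scalarAInfChar 𝒟 fun x => quadForm (W x)⁻¹ e) e
  have hq1 : 1 ≤ q := by
    rw [hq, ← ENNReal.toReal_one]
    refine ENNReal.toReal_mono hQ ((one_le_scalarAInfChar hJ ?_).trans (hle e))
    rw [setAverage_eq, setIntegral_form (hp.locInt_left J), smul_eq_mul, ← form_smul_left,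
      ← setAverage_eq]
    exact (isPosDef_setAverage (hp.locInt_left J) hp.posDef hJ (measure_ne_top J.mem)).form_pos e he
  -- the factor `2` makes the bound for the `A_∞` characteristic strict
  have ht := hp.testingCondition (Q := 2 * q) fun e => by
    refine (hle e).trans_lt ?_
    rw [← ENNReal.ofReal_toReal hQ, ENNReal.ofReal_lt_ofReal_iff (by positivity), ← hq]
    linarith
  have hc := carlesonConst_nonneg D
  have htc : 0 < testConst D := by
    unfold testConst
    positivity
  have hK : 0 < testConst D * A * (2 * q) := by positivity
  refine (hp.tsum_lintegral_le hK ht hf).trans ?_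
  rw [← ENNReal.ofReal_toReal h.finite.ne, ← ENNReal.ofReal_toReal hQ, ← hq, ← hAdef,
    ← ENNReal.ofReal_mul (sqConst_pos D).le,
    ← ENNReal.ofReal_mul (mul_nonneg (sqConst_pos D).le hA.le)]
  gcongr ENNReal.ofReal ?_ * _
  have h1 : A ≤ A * q := le_mul_of_one_le_right hA.le hq1
  rw [sqConst]
  linear_combination 2 * h1

end Matrix

end

end AtomicSq

end

/-- The constant depends only on the dimension `d`: not on the field, the measure space, the
filtration, the weight or the function. Functions of `L²(W)` are locally integrable, so that the
martingale differences make sense. -/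
theorem corollary1p2 (d : ℕ) :
    ∃ C : ℝ≥0, ∀ (𝕜 : Type u) [RCLike 𝕜] (X : Type v) [MeasurableSpace X] (σ : Measure X)
      [SigmaFinite σ] (𝒟 : AtomicFiltration σ) (W : X → Matrix (Fin d) (Fin d) 𝕜),
      IsA2Weight 𝒟 W → ∀ f : X → EuclideanSpace 𝕜 (Fin d), MemL2W σ W f →
        LocInt 𝒟 f ∧
        eLpNorm (squareFn 𝒟 W f) 2 σ ≤
          C * A2Char 𝒟 W ^ (1 / 2 : ℝ) * AInfChar 𝒟 (fun x => (W x)⁻¹) ^ (1 / 2 : ℝ)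
            * normL2W σ W f := by
  -- the real dimension of `𝕜ᵈ` is at most `2 * d`
  set c := ∑ D ∈ Finset.range (2 * d + 1), sqConst D with hc
  refine ⟨c.toNNReal ^ (1 / 2 : ℝ), fun 𝕜 _ X _ σ _ 𝒟 W h f ⟨hf, hfin⟩ => ?_⟩
  have hc0 : 0 < c := Finset.sum_pos (fun D _ => sqConst_pos D) ⟨0, by simp⟩
  have hD : sqConst (Module.finrank ℝ (EuclideanSpace 𝕜 (Fin d))) ≤ c :=
    Finset.single_le_sum (f := sqConst) (fun D _ => (sqConst_pos D).le)
      (Finset.mem_range.2 (Nat.lt_succ_of_le finrank_euclideanSpace_le))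
  have hp := h.isWeightPair
  rw [normL2W_eq] at hfin
  have hloc : LocInt 𝒟 f := hp.locInt_of_lintegral_lt_top hf
    ((ENNReal.rpow_lt_top_iff_of_pos (by norm_num)).1 hfin)
  refine ⟨hloc, ?_⟩
  rw [eLpNorm_squareFn_eq h, normL2W_eq]
  by_cases h0 : ∫⁻ x, ENNReal.ofReal (form (realOp (W x)) (f x)) ∂σ = 0
  · have hf0 := hp.ae_eq_zero hf h0
    have havg (n : ℤ) (x : X) : 𝒟.avg n f x = 0 := by
      rw [AtomicFiltration.avg, setAverage_eq, integral_eq_zero_of_ae (ae_restrict_of_ae hf0),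
        smul_zero]
    simp [havg]
  rw [ENNReal.coe_rpow_of_nonneg _ (by norm_num),
    ← ENNReal.mul_rpow_of_nonneg _ _ (by norm_num), ← ENNReal.mul_rpow_of_nonneg _ _ (by norm_num),
    ← ENNReal.mul_rpow_of_nonneg _ _ (by norm_num)]
  refine ENNReal.rpow_le_rpow ?_ (by norm_num)
  by_cases hQ : AInfChar 𝒟 (fun x => (W x)⁻¹) = ∞
  · have hA := h.a2Char_pos h0
    rw [hQ, ENNReal.mul_top (mul_ne_zero (by simpa using hc0) hA.ne'), ENNReal.top_mul h0]
    exact le_top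
  · refine (h.tsum_lintegral_le hloc h0 hQ).trans ?_
    gcongr
    exact ENNReal.ofReal_le_ofReal hD
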